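/- Let $\mathcal X_0=\{\bullet\}$, and for $d\ge 1$ let $\mathcal X_d$ be the set of families $t=\{N_\tau\}_{\tau\in\mathcal X_{d-1}}$ of non-negative integers with finite support (finite rooted unlabeled trees of depth at most $d$; $N_\tau$ is the number of children of the root whose subtree is $\tau$). Let $|\bullet|=1$ for $\bullet\in\mathcal X_0$ and $|t|=1+\sum_\tau N_\tau|\tau|$ for $d\ge1$; the zero family, i.e. the tree reduced to its root, is also denoted $\bullet\in\mathcal X_d$. For $\lambda>0$, let $GW^{(\lambda)}_0$ be the Dirac mass at $\bullet$, and for $d\ge1$ let $GW^{(\lambda)}_d$ be the law of $\{N_\tau\}_{\tau\in\mathcal X_{d-1}}$ with independent $N_\tau\sim\mathrm{Poi}(\lambda\,GW^{(\lambda)}_{d-1}(\tau))$. For $s\in[0,1]$, let $\mathbb P^{(\lambda,s)}_0=GW^{(\lambda)}_0\otimes GW^{(\lambda)}_0$, and for $d\ge1$ let $\mathbb P^{(\lambda,s)}_d$ be the law of $(\{N_\tau\},\{N'_{\tau}\})$ with $$N_\tau=\Delta_\tau+\sum_{\tau'\in\mathcal X_{d-1}}M_{\tau,\tau'},\qquad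 N'_{\tau'}=\Delta'_{\tau'}+\sum_{\tau\in\mathcal X_{d-1}}M_{\tau,\tau'},$$ where all $\Delta_\tau,\Delta'_\tau,M_{\tau,\tau'}$ are independent Poisson variables of respective parameters $\lambda(1-s)GW^{(\lambda)}_{d-1}(\tau)$, $\lambda(1-s)GW^{(\lambda)}_{d-1}(\tau)$ and $\lambda s\,\mathbb P^{(\lambda,s)}_{d-1}(\tau,\tau')$. Let $$L_d(t,t')=\frac{\mathbb P^{(\lambda,s)}_d(t,t')}{GW^{(\lambda)}_d(t)\,GW^{(\lambda)}_d(t')}$$ be the likelihood ratio. Theorem (decomposition of $L_d$). There are functions $f^{(\lambda)}_{d,\beta}:\mathcal X_d\to\mathbb R$, for $\lambda>0$, $d\ge0$ and $\beta\in\mathcal X_d$ (not depending on $s$), with the following properties; all the series below converge absolutely. (1) For all $\lambda>0$, $d\ge0$, $s\in[0,1]$ (with $0^0=1$) and $t,t'\in\mathcal X_d$, $$L_d(t,t')=\sum_{\beta\in\mathcal X_d}s^{|\beta|-1}f^{(\lambda)}_{d,\beta}(t)f^{(\lambda)}_{d,\beta}(t').$$ (2) For all $\lambda>0$, $d\ge0$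 and $t\in\mathcal X_d$, $f^{(\lambda)}_{d,\bullet}(t)=1$. (3) For all $\lambda>0$, $d\ge0$ and $\beta,\beta'\in\mathcal X_d$, $\sum_{t\in\mathcal X_d}GW^{(\lambda)}_d(t)f^{(\lambda)}_{d,\beta}(t)f^{(\lambda)}_{d,\beta'}(t)=\mathbf 1_{\beta=\beta'}$. (4) For all $\lambda>0$, $d\ge0$ and $t,t'\in\mathcal X_d$, $\sum_{\beta\in\mathcal X_d}f^{(\lambda)}_{d,\beta}(t)f^{(\lambda)}_{d,\beta}(t')=\mathbf 1_{t=t'}/GW^{(\lambda)}_d(t)$. (5) For all $n\ge2$, $d\ge1$ and $\beta^{(i)}=\{\beta^{(i)}_\gamma\}_{\gamma\in\mathcal X_{d-1}}\in\mathcal X_d$, $i=1,\dots,n$, $$\sum_{t\in\mathcal X_d}GW^{(\lambda)}_d(t)f^{(\lambda)}_{d,\beta^{(1)}}(t)\cdots f^{(\lambda)}_{d,\beta^{(n)}}(t)\ \underset{\lambda\to\infty}{\longrightarrow}\ \prod_{\gamma\in\mathcal X_{d-1}}\sqrt{\prod_{i=1}^n\beta^{(i)}_\gamma!}\ \Big[x_1^{\beta^{(1)}_\gamma}\cdots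 x_n^{\beta^{(n)}_\gamma}\Big]e^{\sum_{1\le i<j\le n}x_ix_j},$$ where $[x_1^{m_1}\cdots x_n^{m_n}]F$ is the coefficient of $x_1^{m_1}\cdots x_n^{m_n}$ in the formal power series $F$, and all but finitely many factors of the product over $\gamma$ equal $1$. -/

import Mathlib

open MeasureTheory ProbabilityTheory Filter Topology

/-- Finite rooted unlabeled trees of depth at most `d`: for `d = 0` only the one-node tree, and a
tree of depth at most `d + 1` is a finitely supported family of non-negative integers indexed by
the trees `τ` of depth at most `d` (the number of children of the root with subtree `τ`). -/
def RTree : ℕ → Type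
  | 0 => Unit
  | d + 1 => RTree d →₀ ℕ

namespace RTree

/-- The family of multiplicities of the subtrees hanging from the root. -/
def mult {d : ℕ} (t : RTree (d + 1)) : RTree d →₀ ℕ := t

/-- The tree with a given finitely supported family of multiplicities. -/
def ofFinsupp {d : ℕ} (N : RTree d →₀ ℕ) : RTree (d + 1) := N

/-- The tree reduced to its root, seen as a tree of depth at most `d`. -/
noncomputable def trivialTree : (d : ℕ) → RTree d
  | 0 => ()
  | _ + 1 => ofFinsupp 0

/-- The number of nodes. -/
noncomputable def size : {d : ℕ} → RTree d → ℕ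
  | 0, _ => 1
  | _ + 1, t => 1 + t.mult.sum (fun τ N => N * size τ)

noncomputable instance (d : ℕ) : DecidableEq (RTree d) := Classical.decEq _

/-- The discrete sigma-algebra. -/
instance (d : ℕ) : MeasurableSpace (RTree d) := ⊤

/-- The tree with prescribed multiplicities. Families with infinite support, which have
probability zero in every use below, are sent to the trivial tree. -/
noncomputable def ofMult {d : ℕ} (N : RTree d → ℕ) : RTree (d + 1) :=
  open Classical in
  if h : (Function.support N).Finite then
    ofFinsupp (Finsupp.ofSupportFinite N h) else trivialTree (d + 1)

end RTree

/-- The law of a family of independent Poisson variables with parameters `r i`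
(used with `0 ≤ r i` only). -/
noncomputable def poissonFamily {ι : Type} (r : ι → ℝ) : Measure (ι → ℕ) :=
  Measure.infinitePi (fun i => poissonMeasure (r i).toNNReal)

/-- The Galton-Watson law with Poisson offspring of mean `lam`, truncated at depth `d`. -/
noncomputable def galtonWatson (lam : ℝ) : (d : ℕ) → Measure (RTree d)
  | 0 => Measure.dirac (RTree.trivialTree 0)
  | d + 1 =>
    (poissonFamily (fun τ : RTree d => lam * (galtonWatson lam d).real {τ})).map RTree.ofMult

/-- The null model: two independent Galton-Watson trees. -/
noncomputable def nullModel (lam : ℝ) (d : ℕ) : Measure (RTree d × RTree d) :=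
  (galtonWatson lam d).prod (galtonWatson lam d)

/-- The pair of trees obtained from the families `Δ`, `Δ'` and `M`: its multiplicities are
`N τ = Δ τ + ∑ τ', M (τ, τ')` and `N' τ' = Δ' τ' + ∑ τ, M (τ, τ')`. -/
noncomputable def correlatedPair {d : ℕ}
    (ω : (RTree d → ℕ) × (RTree d → ℕ) × (RTree d × RTree d → ℕ)) :
    RTree (d + 1) × RTree (d + 1) :=
  (RTree.ofMult (fun τ => ω.1 τ + ∑' τ', ω.2.2 (τ, τ')),
    RTree.ofMult (fun τ' => ω.2.1 τ' + ∑' τ, ω.2.2 (τ, τ')))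

/-- The correlated model: the law of the pair built from independent Poisson families `Δ`, `Δ'`
and `M` of parameters `lam (1 - s) GW(τ)`, `lam (1 - s) GW(τ')` and `lam s P(τ, τ')`, where `GW`
and `P` are the Galton-Watson law and the correlated law one level below. -/
noncomputable def correlatedModel (lam s : ℝ) : (d : ℕ) → Measure (RTree d × RTree d)
  | 0 => nullModel lam 0
  | d + 1 =>
    ((poissonFamily (fun τ : RTree d => lam * (1 - s) * (galtonWatson lam d).real {τ})).prod
      ((poissonFamily (fun τ : RTree d => lam * (1 - s) * (galtonWatson lam d).real {τ})).prod
        (poissonFamily (fun p : RTree d × RTree d =>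
          lam * s * (correlatedModel lam s d).real {p})))).map correlatedPair

/-- The likelihood ratio between the correlated model and the null model. -/
noncomputable def likelihoodRatio (lam s : ℝ) (d : ℕ) (t t' : RTree d) : ℝ :=
  (correlatedModel lam s d).real {(t, t')} / (nullModel lam d).real {(t, t')}

/-- The formal power series `exp (∑_{i < j} x_i x_j)` in the variables `x_1, …, x_n`. -/
noncomputable def expPairs (n : ℕ) : MvPowerSeries (Fin n) ℝ :=
  (PowerSeries.exp ℝ).subst
    (∑ i : Fin n, ∑ j ∈ Finset.Ioi i,
      (MvPowerSeries.X i * MvPowerSeries.X j : MvPowerSeries (Fin n) ℝ))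

/-- The Hermite linearization coefficient
`√(m_1! ⋯ m_n!) [x_1^{m_1} ⋯ x_n^{m_n}] exp (∑_{i < j} x_i x_j)`. -/
noncomputable def hermiteCoeff {n : ℕ} (m : Fin n → ℕ) : ℝ :=
  Real.sqrt (∏ i, ((m i).factorial : ℝ)) *
    MvPowerSeries.coeff (Finsupp.equivFunOnFinite.symm m) (expPairs n)

/-! The functions `treeChaos` are built recursively in the depth as multivariate Charlier functions.
A tree of depth at most `d + 1` is a Poisson configuration `t` of trees `τ` with intensity `lam * p
τ`, where `p` is the Galton-Watson law one level below. If `φ γ` is an orthonormal family for `p`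
with `φ o = 1`, the new family consists of the normalized coefficients in `x` of `exp(-√λ x_o) ∏_τ
(1 + λ^{-1/2} ∑_γ φ_γ(τ) x_γ)^{t τ}`. Formally, the Poisson expectation of this series is `1` and
that of the product of two copies is `exp(∑_γ x_γ y_γ)`, which is orthonormality. For `n` copies it
is the exponential of `∑_γ ∑_{i<j} x_{i,γ} x_{j,γ}` plus terms of order `λ^{-1/2}`, whence the
Hermite limit.

The proof replaces these interchanges of infinite sums by two exact finite identities. Multiplying
the series by one more factor shows that adding a point to `t` lowers `β`
(`chaos_add_single_right`); differentiating it in `x_γ` shows that adding a point to `β` removes one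
from `t` (`chaos_add_single_left`). Together with the Poisson identity `(k+1) w(k+1) = r w(k)` they
give every statement by induction.

The expansion of the likelihood ratio is an instance of `hasSum_poissonChaos_mul`: a kernel is
determined by its value at two empty configurations and by what happens when a point is added, and
the chaos expansion obeys the same rules. For the likelihood ratio these rules say that a new child
of the root is either unpaired or paired with a child of the other tree
(`likelihoodRatio_add_single`); they come from counting points in `pairMass_add_single`.
Completeness is a second instance of the same lemma, with weights `1` and the diagonal kernel.

Orthonormality and moments come from integration by parts (`hasSum_poissonChaos_add_single_mul`). In
the moment recursion `hasSum_prod_poissonChaos` each removed point costs `λ^{-1/2}` against a global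
`√λ`, so in the limit only single removals survive. What remains is the recursion
`sqrt_mul_hermiteProd` of the Hermite coefficients, obtained by differentiating `exp(∑_{i<j} x_i
x_j)`. -/

theorem Finsupp.induction_add_single_one {X : Type*} {P : (X →₀ ℕ) → Prop} (t : X →₀ ℕ)
    (zero : P 0) (add : ∀ t x, P t → P (t + Finsupp.single x 1)) : P t := by
  induction t using Finsupp.induction with
  | zero => exact zero
  | single_add x n t _ _ ih =>
    clear * - ih add
    induction n with
    | zero => simpa using ih
    | succ n hn =>
      have := add _ x hn
      rwa [add_right_comm, ← Finsupp.single_add] at this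

/-! ### Generating series of the chaos functions: creation and annihilation identities -/

section ChaosSeries

variable {Γ X : Type*}

/-- The formal linear form `∑ γ, c γ x_γ`, possibly with infinitely many terms. -/
noncomputable def linearForm (c : Γ → ℝ) : MvPowerSeries Γ ℝ :=
  fun m => if m.degree = 1 then ∑ γ ∈ m.support, c γ else 0

/-- The formal power series `exp (∑ γ, v γ x_γ)`. -/
noncomputable def expLinearForm (v : Γ → ℝ) : MvPowerSeries Γ ℝ :=
  fun m => m.prod fun γ k => v γ ^ k / (k.factorial : ℝ)

theorem coeff_single_linearForm (c : Γ → ℝ) (γ : Γ) :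
    MvPowerSeries.coeff (Finsupp.single γ 1) (linearForm c) = c γ := by
  change linearForm c (Finsupp.single γ 1) = _
  rw [linearForm, if_pos (by simp), Finsupp.support_single _ one_ne_zero,
    Finset.sum_singleton]

theorem coeff_linearForm_of_degree_ne (c : Γ → ℝ) {m : Γ →₀ ℕ} (hm : m.degree ≠ 1) :
    MvPowerSeries.coeff m (linearForm c) = 0 := by
  change linearForm c m = _
  rw [linearForm, if_neg hm]

/-- Only monomials of degree one that divide `β` contribute, so the sum is finite even when `Γ` is
infinite. This is why no convergence question arises in the annihilation identity. -/
theorem coeff_linearForm_mul (c : Γ → ℝ) (E : MvPowerSeries Γ ℝ) (β : Γ →₀ ℕ) :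
    MvPowerSeries.coeff β (linearForm c * E) =
      ∑ γ ∈ β.support, c γ * MvPowerSeries.coeff (β - Finsupp.single γ 1) E := by
  classical
  rw [MvPowerSeries.coeff_mul]
  symm
  refine Finset.sum_of_injOn (fun γ => (Finsupp.single γ 1, β - Finsupp.single γ 1)) ?_ ?_ ?_ ?_
  · intro γ _ γ' _ h
    exact Finsupp.single_left_injective one_ne_zero (Prod.ext_iff.mp h).1
  · intro γ hγ
    rw [Finset.mem_coe, Finset.HasAntidiagonal.mem_antidiagonal]
    refine add_tsub_cancel_of_le ?_
    rw [Finsupp.single_le_iff]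
    exact Nat.one_le_iff_ne_zero.mpr (Finsupp.mem_support_iff.mp hγ)
  · rintro ⟨p, q⟩ hpq hn
    rw [Finset.HasAntidiagonal.mem_antidiagonal] at hpq
    dsimp only at hpq ⊢
    by_cases hp : p.degree = 1
    · exfalso
      apply hn
      obtain ⟨γ, rfl⟩ := (Finsupp.sum_eq_one_iff p).mp hp
      refine ⟨γ, ?_, ?_⟩
      · rw [Finset.mem_coe, Finsupp.mem_support_iff, ← hpq]
        simp
      · simp [← hpq]
    · rw [coeff_linearForm_of_degree_ne c hp, zero_mul]
  · intro γ _
    rw [coeff_single_linearForm]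

theorem pderiv_linearForm (c : Γ → ℝ) (γ : Γ) :
    MvPowerSeries.pderiv ℝ γ (linearForm c) = MvPowerSeries.C (c γ) := by
  classical
  ext m
  rw [MvPowerSeries.coeff_pderiv, MvPowerSeries.coeff_C]
  split_ifs with h
  · subst h
    simp [coeff_single_linearForm]
  · rw [coeff_linearForm_of_degree_ne, zero_mul]
    rw [map_add, Finsupp.degree_single]
    simpa [Finsupp.degree_eq_zero_iff] using h

theorem pderiv_expLinearForm (v : Γ → ℝ) (γ : Γ) :
    MvPowerSeries.pderiv ℝ γ (expLinearForm v) = MvPowerSeries.C (v γ) * expLinearForm v := by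
  classical
  ext m
  rw [MvPowerSeries.coeff_pderiv, MvPowerSeries.coeff_C_mul]
  change expLinearForm v (m + Finsupp.single γ 1) * _ = v γ * expLinearForm v m
  unfold expLinearForm
  have hs : ∀ n : Γ →₀ ℕ, n.support ⊆ insert γ m.support →
      (n.prod fun γ k => v γ ^ k / (k.factorial : ℝ)) =
      (v γ ^ n γ / ((n γ).factorial : ℝ)) *
        ∏ i ∈ (insert γ m.support).erase γ, v i ^ n i / ((n i).factorial : ℝ) := by
    intro n hn
    rw [Finsupp.prod_of_support_subset _ hn _ (by simp), Finset.mul_prod_erase _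
      (fun i => v i ^ n i / ((n i).factorial : ℝ)) (Finset.mem_insert_self _ _)]
  rw [hs m (Finset.subset_insert _ _), hs (m + Finsupp.single γ 1) (by
    intro i hi
    by_cases hiγ : i = γ
    · simp [hiγ]
    · rw [Finsupp.mem_support_iff, Finsupp.add_apply, Finsupp.single_eq_of_ne hiγ, add_zero] at hi
      simp [hi])]
  have : ∏ i ∈ (insert γ m.support).erase γ,
      v i ^ (m + Finsupp.single γ 1 : Γ →₀ ℕ) i / (((m + Finsupp.single γ 1 : Γ →₀ ℕ) i).factorial : ℝ) =
      ∏ i ∈ (insert γ m.support).erase γ, v i ^ m i / ((m i).factorial : ℝ) := by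
    refine Finset.prod_congr rfl fun i hi => ?_
    rw [Finsupp.add_apply, Finsupp.single_eq_of_ne (Finset.ne_of_mem_erase hi), add_zero]
  rw [this, Finsupp.add_apply, Finsupp.single_eq_same, Nat.factorial_succ, pow_succ]
  push_cast
  have h1 : (m γ : ℝ) + 1 ≠ 0 := by positivity
  field_simp

variable (v : Γ → ℝ) (a : X → Γ → ℝ)

/-- The series `exp (∑ γ, v γ x_γ) ∏ τ, (1 + ∑ γ, a τ γ x_γ) ^ (t τ)`. -/
noncomputable def chaosSeries (t : X →₀ ℕ) : MvPowerSeries Γ ℝ :=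
  expLinearForm v * t.prod fun τ n => (1 + linearForm (a τ)) ^ n

theorem chaosSeries_add_single (t : X →₀ ℕ) (τ : X) :
    chaosSeries v a (t + Finsupp.single τ 1) =
      (1 + linearForm (a τ)) * chaosSeries v a t := by
  classical
  unfold chaosSeries
  rw [Finsupp.prod_add_index' (by simp) (fun _ _ _ => pow_add _ _ _),
    Finsupp.prod_single_index (by simp)]
  ring

/-- The factor `t τ` makes truncated subtraction harmless: it vanishes exactly when there is no
point `τ` to remove. -/
theorem natCast_smul_chaosSeries_add_sub (t : X →₀ ℕ) (τ σ : X) :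
    (t τ : MvPowerSeries Γ ℝ) * chaosSeries v a (t + Finsupp.single σ 1 - Finsupp.single τ 1) =
      (t τ : MvPowerSeries Γ ℝ) * ((1 + linearForm (a σ)) *
        chaosSeries v a (t - Finsupp.single τ 1)) := by
  by_cases h : t τ = 0
  · simp [h]
  · rw [← chaosSeries_add_single, tsub_add_eq_add_tsub]
    rw [Finsupp.single_le_iff]
    exact Nat.one_le_iff_ne_zero.mpr h

/-- Product rule: the exponential contributes `v γ`, and differentiating one of the `t τ` equal
factors at `τ` replaces it by `a τ γ`. The induction adds the points one at a time. -/
theorem pderiv_chaosSeries (t : X →₀ ℕ) (γ : Γ) :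
    MvPowerSeries.pderiv ℝ γ (chaosSeries v a t) =
      MvPowerSeries.C (v γ) * chaosSeries v a t +
        ∑ τ ∈ t.support, (t τ : MvPowerSeries Γ ℝ) * MvPowerSeries.C (a τ γ) *
          chaosSeries v a (t - Finsupp.single τ 1) := by
  classical
  induction t using Finsupp.induction_add_single_one with
  | zero => simp [chaosSeries, pderiv_expLinearForm]
  | add t σ ih =>
    have hS : (t + Finsupp.single σ 1).support = insert σ t.support := by
      ext i
      by_cases hi : i = σ
      · simp [hi]
      · simp [Finsupp.single_eq_of_ne hi, hi]
    have h1 : ∑ τ ∈ t.support, (t τ : MvPowerSeries Γ ℝ) * MvPowerSeries.C (a τ γ) *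
          chaosSeries v a (t - Finsupp.single τ 1) =
        ∑ τ ∈ insert σ t.support, (t τ : MvPowerSeries Γ ℝ) * MvPowerSeries.C (a τ γ) *
          chaosSeries v a (t - Finsupp.single τ 1) := by
      refine Finset.sum_subset (Finset.subset_insert _ _) fun i _ hi => ?_
      simp [Finsupp.notMem_support_iff.mp hi]
    have h2 : ∀ τ, (((t + Finsupp.single σ 1 : X →₀ ℕ) τ : ℕ) : MvPowerSeries Γ ℝ) *
        MvPowerSeries.C (a τ γ) *
          chaosSeries v a (t + Finsupp.single σ 1 - Finsupp.single τ 1) =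
        (1 + linearForm (a σ)) * ((t τ : MvPowerSeries Γ ℝ) * MvPowerSeries.C (a τ γ) *
          chaosSeries v a (t - Finsupp.single τ 1)) +
        if τ = σ then MvPowerSeries.C (a σ γ) * chaosSeries v a t else 0 := by
      intro τ
      have := natCast_smul_chaosSeries_add_sub v a t τ σ
      by_cases h : τ = σ
      · subst h
        rw [if_pos rfl, Finsupp.add_apply, Finsupp.single_eq_same, add_tsub_cancel_right] at *
        push_cast
        linear_combination (MvPowerSeries.C (a τ γ)) * this
      · rw [if_neg h, Finsupp.add_apply, Finsupp.single_eq_of_ne h, add_zero, add_zero]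
        linear_combination (MvPowerSeries.C (a τ γ)) * this
    rw [hS, Finset.sum_congr rfl fun τ _ => h2 τ, Finset.sum_add_distrib, ← Finset.mul_sum, ← h1,
      Finset.sum_ite_eq', if_pos (Finset.mem_insert_self _ _), chaosSeries_add_single,
      Derivation.leibniz, ih]
    simp only [map_add, pderiv_linearForm, smul_eq_mul, MvPowerSeries.pderiv_one]
    ring

/-- The chaos functions: normalized coefficients of `chaosSeries`. -/
noncomputable def chaos (β : Γ →₀ ℕ) (t : X →₀ ℕ) : ℝ :=
  √(β.prod fun _ k => (k.factorial : ℝ)) * MvPowerSeries.coeff β (chaosSeries v a t)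

theorem sqrt_prod_factorial_add_single (β : Γ →₀ ℕ) (γ : Γ) :
    √((β + Finsupp.single γ 1).prod fun _ k => (k.factorial : ℝ)) =
      √(β γ + 1) * √(β.prod fun _ k => (k.factorial : ℝ)) := by
  classical
  rw [← Real.sqrt_mul (by positivity)]
  congr 1
  have hs : ∀ n : Γ →₀ ℕ, n.support ⊆ insert γ β.support →
      (n.prod fun _ k => (k.factorial : ℝ)) =
      ((n γ).factorial : ℝ) *
        ∏ i ∈ (insert γ β.support).erase γ, ((n i).factorial : ℝ) := by
    intro n hn
    rw [Finsupp.prod_of_support_subset _ hn _ (by simp), Finset.mul_prod_erase _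
      (fun i => ((n i).factorial : ℝ)) (Finset.mem_insert_self _ _)]
  rw [hs β (Finset.subset_insert _ _), hs (β + Finsupp.single γ 1) (by
    intro i hi
    by_cases hiγ : i = γ
    · simp [hiγ]
    · rw [Finsupp.mem_support_iff, Finsupp.add_apply, Finsupp.single_eq_of_ne hiγ, add_zero] at hi
      simp [hi])]
  have : ∏ i ∈ (insert γ β.support).erase γ, (((β + Finsupp.single γ 1 : Γ →₀ ℕ) i).factorial : ℝ) =
      ∏ i ∈ (insert γ β.support).erase γ, ((β i).factorial : ℝ) := by
    refine Finset.prod_congr rfl fun i hi => ?_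
    rw [Finsupp.add_apply, Finsupp.single_eq_of_ne (Finset.ne_of_mem_erase hi), add_zero]
  rw [this, Finsupp.add_apply, Finsupp.single_eq_same, Nat.factorial_succ]
  push_cast
  ring

theorem chaos_zero_left (t : X →₀ ℕ) : chaos v a 0 t = 1 := by
  have : MvPowerSeries.constantCoeff (chaosSeries v a t) = 1 := by
    induction t using Finsupp.induction_add_single_one with
    | zero =>
      rw [← MvPowerSeries.coeff_zero_eq_constantCoeff_apply]
      simp only [chaosSeries, Finsupp.prod_zero_index, mul_one]
      change expLinearForm v 0 = 1
      simp [expLinearForm]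
    | add t σ ih =>
      have : MvPowerSeries.constantCoeff (linearForm (a σ)) = 0 := by
        rw [← MvPowerSeries.coeff_zero_eq_constantCoeff_apply, coeff_linearForm_of_degree_ne]
        simp
      rw [chaosSeries_add_single, map_mul, ih, map_add, this]
      simp
  rw [chaos, MvPowerSeries.coeff_zero_eq_constantCoeff_apply, this]
  simp

theorem chaos_zero_right (β : Γ →₀ ℕ) :
    chaos v a β 0 = √(β.prod fun _ k => (k.factorial : ℝ)) *
      β.prod fun γ k => v γ ^ k / (k.factorial : ℝ) := by
  rw [chaos, chaosSeries, Finsupp.prod_zero_index, mul_one]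
  rfl

/-- Adding a point to the configuration acts on the chaos functions by annihilation. -/
theorem chaos_add_single_right (β : Γ →₀ ℕ) (t : X →₀ ℕ) (τ : X) :
    chaos v a β (t + Finsupp.single τ 1) = chaos v a β t +
      ∑ γ ∈ β.support, a τ γ * √(β γ) * chaos v a (β - Finsupp.single γ 1) t := by
  have : ∀ γ ∈ β.support, a τ γ * √(β γ) * chaos v a (β - Finsupp.single γ 1) t =
      √(β.prod fun _ k => (k.factorial : ℝ)) *
        (a τ γ * MvPowerSeries.coeff (β - Finsupp.single γ 1) (chaosSeries v a t)) := by
    intro γ hγ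
    obtain ⟨β', rfl⟩ : ∃ β', β = β' + Finsupp.single γ 1 := by
      refine ⟨β - Finsupp.single γ 1, (tsub_add_cancel_of_le ?_).symm⟩
      rw [Finsupp.single_le_iff]
      exact Nat.one_le_iff_ne_zero.mpr (Finsupp.mem_support_iff.mp hγ)
    rw [sqrt_prod_factorial_add_single, add_tsub_cancel_right, chaos, Finsupp.add_apply,
      Finsupp.single_eq_same]
    push_cast
    ring
  rw [Finset.sum_congr rfl this, ← Finset.mul_sum, ← coeff_linearForm_mul, chaos, chaos,
    chaosSeries_add_single, ← mul_add, add_mul, one_mul, map_add]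

/-- The chaos functions are created by integration by parts. -/
theorem chaos_add_single_left (β : Γ →₀ ℕ) (t : X →₀ ℕ) (γ : Γ) :
    √(β γ + 1) * chaos v a (β + Finsupp.single γ 1) t = v γ * chaos v a β t +
      ∑ τ ∈ t.support, t τ * a τ γ * chaos v a β (t - Finsupp.single τ 1) := by
  have h := congrArg (MvPowerSeries.coeff β) (pderiv_chaosSeries v a t γ)
  rw [MvPowerSeries.coeff_pderiv, map_add, map_sum, MvPowerSeries.coeff_C_mul] at h
  have h2 : ∀ τ, MvPowerSeries.coeff β ((t τ : MvPowerSeries Γ ℝ) * MvPowerSeries.C (a τ γ) *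
          chaosSeries v a (t - Finsupp.single τ 1)) =
      t τ * a τ γ * MvPowerSeries.coeff β (chaosSeries v a (t - Finsupp.single τ 1)) := by
    intro τ
    rw [mul_assoc, ← nsmul_eq_mul, map_nsmul, MvPowerSeries.coeff_C_mul, nsmul_eq_mul, mul_assoc]
  simp only [h2] at h
  unfold chaos
  rw [sqrt_prod_factorial_add_single]
  have h3 : √((β γ : ℝ) + 1) * √((β γ : ℝ) + 1) = β γ + 1 := Real.mul_self_sqrt (by positivity)
  have h4 : ∑ τ ∈ t.support, t τ * a τ γ * (√(β.prod fun _ k => (k.factorial : ℝ)) *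
      MvPowerSeries.coeff β (chaosSeries v a (t - Finsupp.single τ 1))) =
      √(β.prod fun _ k => (k.factorial : ℝ)) * ∑ τ ∈ t.support, t τ * a τ γ *
      MvPowerSeries.coeff β (chaosSeries v a (t - Finsupp.single τ 1)) := by
    rw [Finset.mul_sum]
    exact Finset.sum_congr rfl fun _ _ => by ring
  rw [h4]
  linear_combination (√(β.prod fun _ k => (k.factorial : ℝ))) * h +
    √(β.prod fun _ k => (k.factorial : ℝ)) *
      MvPowerSeries.coeff (β + Finsupp.single γ 1) (chaosSeries v a t) * h3

end ChaosSeries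

/-! ### Removing a point, and reindexing sums by adding one -/

theorem Finsupp.sub_add_single_of_mem_support {X : Type*} {β : X →₀ ℕ} {γ : X}
    (h : γ ∈ β.support) : β - Finsupp.single γ 1 + Finsupp.single γ 1 = β := by
  refine tsub_add_cancel_of_le ?_
  rw [Finsupp.single_le_iff]
  exact Nat.one_le_iff_ne_zero.mpr (Finsupp.mem_support_iff.mp h)

theorem HasSum.mul_real {ι κ : Type*} {f : ι → ℝ} {g : κ → ℝ} {a b : ℝ} (hf : HasSum f a)
    (hg : HasSum g b) : HasSum (fun p : ι × κ => f p.1 * g p.2) (a * b) :=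
  hf.mul hg (summable_mul_of_summable_norm hf.summable.norm hg.summable.norm)

/-- Reindexing a sum over pairs `(γ, β)` by `β ↦ β + single γ 1`. -/
theorem HasSum.of_add_single {Γ : Type*} {H : Γ → (Γ →₀ ℕ) → ℝ} {a : ℝ}
    (h0 : ∀ γ β, β γ = 0 → H γ β = 0)
    (h : HasSum (fun p : Γ × (Γ →₀ ℕ) => H p.1 (p.2 + Finsupp.single p.1 1)) a) :
    HasSum (fun β => ∑ γ ∈ β.support, H γ β) a := by
  have hinj : Function.Injective
      (fun p : Γ × (Γ →₀ ℕ) => (p.2 + Finsupp.single p.1 1, p.1)) := by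
    rintro ⟨γ, β⟩ ⟨γ', β'⟩ h
    simp only [Prod.mk.injEq] at h
    obtain ⟨h1, rfl⟩ := h
    simpa using h1
  have h1 : HasSum (fun p : (Γ →₀ ℕ) × Γ => H p.2 p.1) a := by
    refine (hinj.hasSum_iff ?_).mp h
    rintro ⟨β, γ⟩ hp
    refine h0 γ β ?_
    by_contra hne
    exact hp ⟨(γ, β - Finsupp.single γ 1), Prod.ext
      (Finsupp.sub_add_single_of_mem_support (Finsupp.mem_support_iff.mpr hne)) rfl⟩
  refine h1.prod_fiberwise fun β => ?_
  refine hasSum_sum_of_ne_finset_zero fun γ hγ => ?_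
  exact h0 γ β (Finsupp.notMem_support_iff.mp hγ)

/-! ### Expansion of kernels in Poisson chaos functions -/

section PoissonChaos

variable {Γ X : Type*}

open Classical in
/-- The Poisson chaos functions (multivariate Charlier functions) of a family `φ` of functions of
mean zero, except for `φ o` which is constant equal to `1`. -/
noncomputable def poissonChaos (lam : ℝ) (φ : Γ → X → ℝ) (o : Γ) (β : Γ →₀ ℕ) (t : X →₀ ℕ) : ℝ :=
  chaos (fun γ => if γ = o then -√lam else 0) (fun τ γ => φ γ τ / √lam) β t

variable (lam : ℝ) (φ : Γ → X → ℝ) (o : Γ)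

theorem poissonChaos_zero_left (t : X →₀ ℕ) : poissonChaos lam φ o 0 t = 1 :=
  chaos_zero_left _ _ t

theorem poissonChaos_add_single_right (β : Γ →₀ ℕ) (t : X →₀ ℕ) (τ : X) :
    poissonChaos lam φ o β (t + Finsupp.single τ 1) = poissonChaos lam φ o β t +
      ∑ γ ∈ β.support, φ γ τ / √lam * √(β γ) *
        poissonChaos lam φ o (β - Finsupp.single γ 1) t :=
  chaos_add_single_right _ _ β t τ

open Classical in
theorem poissonChaos_add_single_left (β : Γ →₀ ℕ) (t : X →₀ ℕ) (γ : Γ) :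
    √(β γ + 1) * poissonChaos lam φ o (β + Finsupp.single γ 1) t =
      (if γ = o then -√lam else 0) * poissonChaos lam φ o β t +
      ∑ τ ∈ t.support, t τ * (φ γ τ / √lam) *
        poissonChaos lam φ o β (t - Finsupp.single τ 1) :=
  chaos_add_single_left _ _ β t γ

variable {lam φ o} {s : ℝ} {q : Γ → ℝ} {ℓ : X → X → ℝ}

/-- At the empty configuration the series reduces to `exp(-√λ x_o)`, so only the multiples of
`single o 1` contribute and the sum is the exponential series of `lam * s`. -/
theorem hasSum_poissonChaos_zero_zero (hlam : 0 < lam) (hqo : q o = s) :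
    HasSum (fun β : Γ →₀ ℕ => (β.prod fun γ n => q γ ^ n) * poissonChaos lam φ o β 0 *
      poissonChaos lam φ o β 0) (Real.exp (lam * s)) := by
  classical
  have hinj : Function.Injective (fun k : ℕ => Finsupp.single o k) :=
    Finsupp.single_injective o
  refine (hinj.hasSum_iff ?_).mp ?_
  · intro β hβ
    have : ∃ γ ∈ β.support, γ ≠ o := by
      by_contra! hcon
      refine hβ ⟨β o, ?_⟩
      ext γ
      by_cases h : γ = o
      · simp [h]
      · rw [Finsupp.single_eq_of_ne h]
        by_contra h'
        exact h (hcon γ (Finsupp.mem_support_iff.mpr (Ne.symm h')))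
    obtain ⟨γ, hγ, hγo⟩ := this
    have h0 : poissonChaos lam φ o β 0 = 0 := by
      rw [poissonChaos, chaos_zero_right, mul_eq_zero]
      refine Or.inr (Finset.prod_eq_zero hγ ?_)
      dsimp only
      rw [if_neg hγo, zero_pow (Finsupp.mem_support_iff.mp hγ), zero_div]
    rw [h0, mul_zero]
  · have h := NormedSpace.expSeries_div_hasSum_exp (lam * s : ℝ)
    rw [← Real.exp_eq_exp_ℝ] at h
    convert! h using 1
    ext k
    have h1 : (√(k.factorial : ℝ)) * √(k.factorial : ℝ) = k.factorial :=
      Real.mul_self_sqrt (by positivity)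
    have h2 : (-√lam) ^ k * (-√lam) ^ k = lam ^ k := by
      rw [← mul_pow, neg_mul_neg, Real.mul_self_sqrt hlam.le]
    have h3 : (k.factorial : ℝ) ≠ 0 := by positivity
    simp only [Function.comp_apply, poissonChaos, chaos_zero_right]
    rw [Finsupp.prod_single_index (by simp), Finsupp.prod_single_index (by simp),
      Finsupp.prod_single_index (by simp), if_pos rfl, hqo, mul_pow, ← h2]
    field_simp
    linear_combination (s ^ k * (-√lam) ^ k * (-√lam) ^ k) * h1

/-- Annihilation at `t` removes some `γ` from `β` with a factor `√(β γ)`. Reindexing by `β + single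
γ 1` turns the weight into `q γ` times the old one, and the square root is what the creation
identity at `t'` absorbs. Summing over `γ` then yields `-s` from `γ = o` and `s / lam * ℓ τ τ'` for
each point `τ'` removed from `t'`. -/
theorem hasSum_poissonChaos_add_single (hlam : 0 < lam) (hqo : q o = s) (hφo : ∀ τ, φ o τ = 1)
    (hℓ : ∀ τ τ', HasSum (fun γ => q γ * φ γ τ * φ γ τ') (s * ℓ τ τ'))
    {t t' : X →₀ ℕ} {τ : X} {k₀ : ℝ} {k : X → ℝ}
    (h₀ : HasSum (fun β : Γ →₀ ℕ => (β.prod fun γ n => q γ ^ n) * poissonChaos lam φ o β t *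
      poissonChaos lam φ o β t') k₀)
    (hk : ∀ τ' ∈ t'.support, HasSum (fun β : Γ →₀ ℕ => (β.prod fun γ n => q γ ^ n) *
      poissonChaos lam φ o β t * poissonChaos lam φ o β (t' - Finsupp.single τ' 1)) (k τ')) :
    HasSum (fun β : Γ →₀ ℕ => (β.prod fun γ n => q γ ^ n) *
      poissonChaos lam φ o β (t + Finsupp.single τ 1) * poissonChaos lam φ o β t')
      ((1 - s) * k₀ + s / lam * ∑ τ' ∈ t'.support, t' τ' * ℓ τ τ' * k τ') := by
  classical
  have hc : √lam ≠ 0 := (Real.sqrt_pos.mpr hlam).ne'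
  have hcc : √lam * √lam = lam := Real.mul_self_sqrt hlam.le
  have hv : HasSum (fun γ => q γ * (φ γ τ / √lam) * (if γ = o then -√lam else 0)) (-s) := by
    convert hasSum_ite_eq o (-s) using 2 with γ
    split_ifs with h
    · rw [h, hqo, hφo]
      field_simp
    · ring
  have ha : ∀ τ', HasSum (fun γ => q γ * (φ γ τ / √lam) * (φ γ τ' / √lam)) (s / lam * ℓ τ τ') := by
    intro τ'
    have h1 : (√lam)⁻¹ * (√lam)⁻¹ = lam⁻¹ := by rw [← mul_inv, hcc]
    have h2 : s / lam * ℓ τ τ' = lam⁻¹ * (s * ℓ τ τ') := by ring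
    rw [h2]
    convert! (hℓ τ τ').mul_left lam⁻¹ using 1
    ext γ
    linear_combination (q γ * φ γ τ * φ γ τ') * h1
  -- After the creation identity the sum over pairs `(γ, β)` is a finite sum of products of a series
  -- in `γ` and a series in `β`.
  have hsum := (hv.mul_real h₀).add
    (hasSum_sum fun τ' hτ' => ((ha τ').mul_real (hk τ' hτ')).mul_left (t' τ' : ℝ))
  have hw : ∀ (β : Γ →₀ ℕ) (γ : Γ), ((β + Finsupp.single γ 1).prod fun γ n => q γ ^ n) =
      q γ * β.prod fun γ n => q γ ^ n := by
    intro β γ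
    rw [Finsupp.prod_add_index' (by simp) (fun _ _ _ => pow_add _ _ _),
      Finsupp.prod_single_index (by simp), pow_one, mul_comm]
  have hH := HasSum.of_add_single (H := fun γ β => (β.prod fun γ n => q γ ^ n) *
    (φ γ τ / √lam * √(β γ) * poissonChaos lam φ o (β - Finsupp.single γ 1) t) *
      poissonChaos lam φ o β t') (a := -s * k₀ + ∑ τ' ∈ t'.support,
        (t' τ' : ℝ) * (s / lam * ℓ τ τ' * k τ')) (by intro γ β h; simp [h]) (by
    convert hsum using 2 with p
    obtain ⟨γ, β⟩ := p
    have h1 := poissonChaos_add_single_left lam φ o β t' γ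
    dsimp only
    rw [hw, add_tsub_cancel_right, Finsupp.add_apply, Finsupp.single_eq_same]
    push_cast
    have h2 : ∀ x : ℝ, q γ * x * (φ γ τ / √lam * √(β γ + 1) * poissonChaos lam φ o β t) *
        poissonChaos lam φ o (β + Finsupp.single γ 1) t' =
        q γ * x * (φ γ τ / √lam) * poissonChaos lam φ o β t *
          (√(β γ + 1) * poissonChaos lam φ o (β + Finsupp.single γ 1) t') := fun x => by ring
    rw [h2, h1, mul_add, Finset.mul_sum]
    congr 1
    · ring
    · exact Finset.sum_congr rfl fun _ _ => by ring)
  convert h₀.add hH using 1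
  · ext β
    rw [poissonChaos_add_single_right, mul_add, add_mul, Finset.mul_sum, Finset.sum_mul]
  · rw [Finset.mul_sum, ← add_assoc]
    congr 1
    · ring
    · exact Finset.sum_congr rfl fun _ _ => by ring

/-- Expansion of a kernel on configurations in Poisson chaos functions. -/
theorem hasSum_poissonChaos_mul (hlam : 0 < lam) (hqo : q o = s) (hφo : ∀ τ, φ o τ = 1)
    (hℓ : ∀ τ τ', HasSum (fun γ => q γ * φ γ τ * φ γ τ') (s * ℓ τ τ'))
    {L : (X →₀ ℕ) → (X →₀ ℕ) → ℝ} (h₀ : L 0 0 = Real.exp (lam * s))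
    (hr : ∀ t' τ', L 0 (t' + Finsupp.single τ' 1) = (1 - s) * L 0 t')
    (hl : ∀ t τ t', L (t + Finsupp.single τ 1) t' = (1 - s) * L t t' +
      s / lam * ∑ τ' ∈ t'.support, t' τ' * ℓ τ τ' * L t (t' - Finsupp.single τ' 1))
    (t t' : X →₀ ℕ) :
    HasSum (fun β : Γ →₀ ℕ => (β.prod fun γ n => q γ ^ n) * poissonChaos lam φ o β t *
      poissonChaos lam φ o β t') (L t t') := by
  induction t using Finsupp.induction_add_single_one generalizing t' with
  | zero =>
    induction t' using Finsupp.induction_add_single_one with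
    | zero =>
      rw [h₀]
      exact hasSum_poissonChaos_zero_zero hlam hqo
    | add t' τ' ih =>
      -- The series is symmetric in the two configurations, so the point is added to the first slot
      -- with an empty second one; the pairing sum is then empty.
      have := hasSum_poissonChaos_add_single (τ := τ') (k := 0) (t := t') (t' := 0) hlam hqo hφo hℓ
        (by simpa only [mul_right_comm] using ih) (by simp)
      rw [hr]
      simpa [mul_right_comm] using this
  | add t τ ih =>
    rw [hl]
    exact hasSum_poissonChaos_add_single hlam hqo hφo hℓ (ih t') fun τ' _ => ih _

end PoissonChaos

/-! ### Orthonormality and moments of the Poisson chaos functions -/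

section Moments

variable {Γ X : Type*} {lam : ℝ} {φ : Γ → X → ℝ} {o : Γ} {W : (X →₀ ℕ) → ℝ} {p : X → ℝ}

open Classical in
/-- Integration by parts against a Poisson weight. -/
theorem hasSum_poissonChaos_add_single_mul {κ : Type*}
    (hW : ∀ t τ, W (t + Finsupp.single τ 1) * (t τ + 1) = lam * p τ * W t) {γ : Γ}
    (hφ : HasSum (fun τ => p τ * φ γ τ) (if γ = o then 1 else 0)) {β : Γ →₀ ℕ}
    {G : (X →₀ ℕ) → ℝ} {P : Finset κ} {a : κ → X → ℝ} {g : κ → (X →₀ ℕ) → ℝ}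
    (hG : ∀ t τ, G (t + Finsupp.single τ 1) = G t + ∑ k ∈ P, a k τ * g k t)
    {M₀ : ℝ} {m M : κ → ℝ} (h₀ : HasSum (fun t => W t * (poissonChaos lam φ o β t * G t)) M₀)
    (hm : ∀ k ∈ P, HasSum (fun τ => p τ * φ γ τ * a k τ) (m k))
    (hM : ∀ k ∈ P, HasSum (fun t => W t * (poissonChaos lam φ o β t * g k t)) (M k)) :
    HasSum (fun t => W t * (√(β γ + 1) * poissonChaos lam φ o (β + Finsupp.single γ 1) t * G t))
      (√lam * ∑ k ∈ P, m k * M k) := by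
  have hsum := ((hφ.mul_real h₀).add
    (hasSum_sum fun k hk => (hm k hk).mul_real (hM k hk))).mul_left √lam
  have hH := HasSum.of_add_single
    (H := fun τ t => W t * (t τ * (φ γ τ / √lam) *
      poissonChaos lam φ o β (t - Finsupp.single τ 1) * G t))
    (by intro τ t h; simp [h]) (by
      convert! hsum using 1
      ext ⟨τ, t⟩
      dsimp only
      rw [hG, add_tsub_cancel_right, Finsupp.add_apply, Finsupp.single_eq_same]
      push_cast
      calc _ = (W (t + Finsupp.single τ 1) * (t τ + 1)) * (φ γ τ / √lam) *
            poissonChaos lam φ o β t * (G t + ∑ k ∈ P, a k τ * g k t) := by ring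
        _ = (lam / √lam) * p τ * W t * φ γ τ *
            poissonChaos lam φ o β t * (G t + ∑ k ∈ P, a k τ * g k t) := by
            rw [hW]
            ring
        _ = √lam * (p τ * φ γ τ * (W t * (poissonChaos lam φ o β t * G t)) +
            p τ * φ γ τ * W t * poissonChaos lam φ o β t * ∑ k ∈ P, a k τ * g k t) := by
            rw [Real.div_sqrt]
            ring
        _ = _ := by
            rw [Finset.mul_sum]
            congr 2
            exact Finset.sum_congr rfl fun _ _ => by ring)
  -- The drift `-√lam` at `γ = o` cancels the contribution of the unchanged `G`, whose coefficient
  -- is `√lam` times the mean of `φ γ`. Only the increments of `G` remain.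
  convert! (h₀.mul_left (if γ = o then -√lam else 0)).add hH using 1
  · ext t
    rw [poissonChaos_add_single_left, add_mul, mul_add, Finset.sum_mul, Finset.mul_sum]
    congr 1
    ring
  · split_ifs <;> ring

open Classical in
-- Integration by parts moves a point `γ` from `β` onto the other function, where annihilation
-- removes it from `β'`; orthonormality of the `φ γ` forces the removed index to be `γ` itself.
theorem hasSum_poissonChaos_mul_poissonChaos (hlam : 0 < lam)
    (hW : ∀ t τ, W (t + Finsupp.single τ 1) * (t τ + 1) = lam * p τ * W t)
    (hW1 : HasSum W 1) (hφo : ∀ τ, φ o τ = 1)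
    (hφ : ∀ γ γ', HasSum (fun τ => p τ * φ γ τ * φ γ' τ) (if γ = γ' then 1 else 0))
    (β β' : Γ →₀ ℕ) :
    HasSum (fun t => W t * (poissonChaos lam φ o β t * poissonChaos lam φ o β' t))
      (if β = β' then 1 else 0) := by
  have hc : √lam ≠ 0 := (Real.sqrt_pos.mpr hlam).ne'
  have hφ1 : ∀ γ, HasSum (fun τ => p τ * φ γ τ) (if γ = o then 1 else 0) := by
    intro γ
    simpa [hφo] using hφ γ o
  have hpos : ∀ k : ℕ, √((k : ℝ) + 1) ≠ 0 := fun k => (Real.sqrt_pos.mpr (by positivity)).ne'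
  have hzero : ∀ β : Γ →₀ ℕ, HasSum (fun t => W t * poissonChaos lam φ o β t)
      (if β = 0 then 1 else 0) := by
    intro β
    induction β using Finsupp.induction_add_single_one with
    | zero => simpa [poissonChaos_zero_left] using hW1
    | add β γ ih =>
      -- A constant does not change when a point is added, so the set of increments is empty and the
      -- mean is zero.
      have := hasSum_poissonChaos_add_single_mul (G := fun _ => 1) (P := (∅ : Finset Γ))
        (a := fun _ _ => 0) (g := fun _ _ => 0) (m := 0) (M := 0) hW (hφ1 γ)
        (by simp) (by simpa using ih) (by simp) (by simp)
      have h2 := this.mul_left (√((β γ : ℝ) + 1))⁻¹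
      rw [if_neg (by
        intro h
        simpa using DFunLike.congr_fun h γ)]
      simp only [Finset.sum_empty, mul_zero, mul_one] at h2
      convert! h2 using 1
      ext t
      field_simp [hpos]
  induction β using Finsupp.induction_add_single_one generalizing β' with
  | zero =>
    simp only [poissonChaos_zero_left, one_mul]
    convert! hzero β' using 1
    simp [eq_comm]
  | add β γ ih =>
    have := hasSum_poissonChaos_add_single_mul (G := poissonChaos lam φ o β') (P := β'.support)
      (a := fun γ' τ => φ γ' τ / √lam * √(β' γ'))
      (g := fun γ' => poissonChaos lam φ o (β' - Finsupp.single γ' 1)) hW (hφ1 γ)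
      (fun t τ => poissonChaos_add_single_right lam φ o β' t τ) (ih β')
      (m := fun γ' => (if γ = γ' then 1 else 0) * (√(β' γ') / √lam))
      (fun γ' _ => by
        convert! (hφ γ γ').mul_right (√(β' γ') / √lam) using 1
        ext τ
        ring) (fun γ' _ => ih _)
    have h2 := this.mul_left (√((β γ : ℝ) + 1))⁻¹
    convert! h2 using 1
    · ext t
      field_simp [hpos]
    · simp only [ite_mul, one_mul, zero_mul, Finset.sum_ite_eq]
      by_cases hγ : γ ∈ β'.support
      · rw [if_pos hγ]
        have h3 : β + Finsupp.single γ 1 = β' ↔ β = β' - Finsupp.single γ 1 := by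
          constructor
          · rintro rfl
            rw [add_tsub_cancel_right]
          · rintro rfl
            exact Finsupp.sub_add_single_of_mem_support hγ
        by_cases h : β + Finsupp.single γ 1 = β'
        · rw [if_pos h, if_pos (h3.mp h), ← h, Finsupp.add_apply, Finsupp.single_eq_same]
          push_cast
          field_simp [hpos]
        · rw [if_neg h, if_neg (fun h' => h (h3.mpr h'))]
          simp
      · rw [if_neg hγ, if_neg]
        · simp
        · rintro rfl
          simp at hγ

/-- Removing one point from `β`, or none. -/
noncomputable def removePoint (β : Γ →₀ ℕ) : Option Γ → (Γ →₀ ℕ)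
  | none => β
  | some γ => β - Finsupp.single γ 1

/-- The coefficient of the annihilation operator. -/
noncomputable def removeCoeff (lam : ℝ) (β : Γ →₀ ℕ) : Option Γ → ℝ
  | none => 1
  | some γ => √(β γ) / √lam

theorem degree_removePoint_le (β : Γ →₀ ℕ) (q : Option Γ) :
    (removePoint β q).degree ≤ β.degree := by
  cases q with
  | none => rfl
  | some γ => exact Finsupp.degree_mono tsub_le_self

theorem poissonChaos_add_single_right_option (hφo : ∀ τ, φ o τ = 1) (β : Γ →₀ ℕ) (t : X →₀ ℕ)
    (τ : X) :
    poissonChaos lam φ o β (t + Finsupp.single τ 1) =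
      ∑ q ∈ Finset.insertNone β.support, φ (q.getD o) τ * (removeCoeff lam β q *
        poissonChaos lam φ o (removePoint β q) t) := by
  rw [poissonChaos_add_single_right, Finset.sum_insertNone]
  congr 1
  · simp [hφo, removeCoeff, removePoint]
  · refine Finset.sum_congr rfl fun γ _ => ?_
    simp only [Option.getD_some, removeCoeff, removePoint]
    ring

variable {n : ℕ}

/-- The index tuple obtained from `b` by removing points according to `q`, after having
put `β` in position `i`. -/
noncomputable def removeTuple (b : Fin n → (Γ →₀ ℕ)) (i : Fin n) (β : Γ →₀ ℕ) (q : Fin n → Option Γ) :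
    Fin n → (Γ →₀ ℕ) :=
  Function.update (fun j => removePoint (Function.update b i 0 j) (q j)) i β

/-- The possible ways to remove at most one point in each position other than `i`. -/
noncomputable def removeChoices (b : Fin n → (Γ →₀ ℕ)) (i : Fin n) : Finset (Fin n → Option Γ) :=
  Fintype.piFinset fun j => Finset.insertNone (Function.update b i 0 j).support

theorem none_mem_removeChoices (b : Fin n → (Γ →₀ ℕ)) (i : Fin n) :
    (fun _ => none) ∈ removeChoices b i := by
  simp [removeChoices]

theorem prod_poissonChaos_removeTuple (b : Fin n → (Γ →₀ ℕ)) (i : Fin n) (β : Γ →₀ ℕ)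
    (q : Fin n → Option Γ) (t : X →₀ ℕ) :
    poissonChaos lam φ o β t *
      ∏ j, poissonChaos lam φ o (removePoint (Function.update b i 0 j) (q j)) t =
      ∏ j, poissonChaos lam φ o (removeTuple b i β q j) t := by
  rw [← Finset.mul_prod_erase _ _ (Finset.mem_univ i),
    ← Finset.mul_prod_erase (a := i) _ (fun j => poissonChaos lam φ o (removeTuple b i β q j) t)
      (Finset.mem_univ i)]
  have : removePoint (Function.update b i 0 i) (q i) = 0 := by
    rw [Function.update_self]
    cases q i with
    | none => rfl
    | some γ => simp [removePoint]
  rw [this, poissonChaos_zero_left, one_mul]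
  congr 1
  · simp [removeTuple]
  · refine Finset.prod_congr rfl fun j hj => ?_
    simp only [removeTuple, Function.update_of_ne (Finset.ne_of_mem_erase hj)]

theorem removeTuple_none (b : Fin n → (Γ →₀ ℕ)) (i : Fin n) (β : Γ →₀ ℕ) :
    removeTuple b i β (fun _ => none) = Function.update b i β := by
  ext j : 1
  by_cases h : j = i
  · subst h
    simp [removeTuple]
  · simp [removeTuple, Function.update_of_ne h, removePoint]

/-- The total degree is the induction variable of the moment recursion: it drops strictly at
position `i`, even if nothing is removed elsewhere. -/
theorem sum_degree_removeTuple_lt (b : Fin n → (Γ →₀ ℕ)) (i : Fin n) {β : Γ →₀ ℕ}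
    (hβ : β.degree < (b i).degree) (q : Fin n → Option Γ) :
    ∑ j, (removeTuple b i β q j).degree < ∑ j, (b j).degree := by
  refine Finset.sum_lt_sum (fun j _ => ?_) ⟨i, Finset.mem_univ i, ?_⟩
  · by_cases h : j = i
    · subst h
      simpa [removeTuple] using hβ.le
    · rw [removeTuple, Function.update_of_ne h, Function.update_of_ne h]
      exact degree_removePoint_le _ _
  · simpa [removeTuple] using hβ

open Classical in
/-- Recursion for the moments of the Poisson chaos functions. -/
theorem hasSum_prod_poissonChaos
    (hW : ∀ t τ, W (t + Finsupp.single τ 1) * (t τ + 1) = lam * p τ * W t)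
    (hφo : ∀ τ, φ o τ = 1)
    (hφ : ∀ γ, HasSum (fun τ => p τ * φ γ τ) (if γ = o then 1 else 0))
    (hm : ∀ (k : ℕ) (γ : Fin k → Γ), Summable fun τ => p τ * ∏ j, φ (γ j) τ)
    (b : Fin n → (Γ →₀ ℕ)) (i : Fin n) (β : Γ →₀ ℕ) (γ : Γ)
    (hb : b i = β + Finsupp.single γ 1)
    (hs : ∀ q, Summable fun t => W t * ∏ j, poissonChaos lam φ o (removeTuple b i β q j) t) :
    HasSum (fun t => W t * ∏ j, poissonChaos lam φ o (b j) t)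
      ((√(β γ + 1))⁻¹ * ∑ q ∈ (removeChoices b i).erase (fun _ => none),
        (√lam * ∏ j, removeCoeff lam (Function.update b i 0 j) (q j)) *
        (∑' τ, p τ * ∏ j, φ (Fin.cons (α := fun _ => Γ) γ (fun j => (q j).getD o) j) τ) *
        ∑' t, W t * ∏ j, poissonChaos lam φ o (removeTuple b i β q j) t) := by
  have hpos : √((β γ : ℝ) + 1) ≠ 0 := (Real.sqrt_pos.mpr (by positivity)).ne'
  -- Position `i` is integrated by parts against the product of the others. Expanding that product
  -- at `t + single τ 1` gives one term per choice of removals; the choice removing nothing is `G`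
  -- itself and is therefore erased from the increments.
  have key := hasSum_poissonChaos_add_single_mul (κ := Fin n → Option Γ) (β := β)
    (G := fun t => ∏ j, poissonChaos lam φ o (removePoint (Function.update b i 0 j) none) t)
    (P := (removeChoices b i).erase (fun _ => none))
    (a := fun q τ => ∏ j, φ ((q j).getD o) τ)
    (g := fun q t => (∏ j, removeCoeff lam (Function.update b i 0 j) (q j)) *
      ∏ j, poissonChaos lam φ o (removePoint (Function.update b i 0 j) (q j)) t)
    (M₀ := ∑' t, W t * ∏ j, poissonChaos lam φ o (removeTuple b i β (fun _ => none) j) t)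
    (m := fun q => ∑' τ, p τ *
      ∏ j, φ (Fin.cons (α := fun _ => Γ) γ (fun j => (q j).getD o) j) τ)
    (M := fun q => (∏ j, removeCoeff lam (Function.update b i 0 j) (q j)) *
      ∑' t, W t * ∏ j, poissonChaos lam φ o (removeTuple b i β q j) t)
    hW (hφ γ) (by
      intro t τ
      have h1 : ∏ j, poissonChaos lam φ o (removePoint (Function.update b i 0 j) none)
          (t + Finsupp.single τ 1) = ∑ q ∈ removeChoices b i,
          ∏ j, (φ ((q j).getD o) τ * (removeCoeff lam (Function.update b i 0 j) (q j) *
            poissonChaos lam φ o (removePoint (Function.update b i 0 j) (q j)) t)) := by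
        refine (Finset.prod_congr rfl fun j _ =>
          poissonChaos_add_single_right_option hφo _ t τ).trans ?_
        exact Finset.prod_univ_sum _ fun j q => φ (q.getD o) τ *
          (removeCoeff lam (Function.update b i 0 j) q *
            poissonChaos lam φ o (removePoint (Function.update b i 0 j) q) t)
      rw [h1, ← Finset.add_sum_erase _ _ (none_mem_removeChoices b i)]
      congr 1
      · simp [hφo, removeCoeff]
      · refine Finset.sum_congr rfl fun q _ => ?_
        rw [Finset.prod_mul_distrib, Finset.prod_mul_distrib])
    (by
      simp only [prod_poissonChaos_removeTuple b i β (fun _ => none)]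
      exact (hs _).hasSum)
    (by
      intro q _
      convert! (hm _ (Fin.cons (α := fun _ => Γ) γ (fun j => (q j).getD o))).hasSum using 1
      ext τ
      rw [Fin.prod_univ_succ]
      simp [mul_assoc])
    (by
      intro q _
      convert! (hs q).hasSum.mul_left (∏ j, removeCoeff lam (Function.update b i 0 j) (q j)) using 1
      ext t
      rw [← prod_poissonChaos_removeTuple]
      ring)
  convert! key.mul_left (√((β γ : ℝ) + 1))⁻¹ using 1
  · ext t
    have h1 := prod_poissonChaos_removeTuple (lam := lam) (φ := φ) (o := o) b i (b i)
      (fun _ => none) t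
    rw [removeTuple_none, Function.update_eq_self, hb] at h1
    rw [← h1]
    field_simp [hpos]
  · congr 1
    rw [Finset.mul_sum]
    exact Finset.sum_congr rfl fun _ _ => by ring

open Classical in
theorem summable_prod_poissonChaos
    (hW : ∀ t τ, W (t + Finsupp.single τ 1) * (t τ + 1) = lam * p τ * W t)
    (hW1 : Summable W) (hφo : ∀ τ, φ o τ = 1)
    (hφ : ∀ γ, HasSum (fun τ => p τ * φ γ τ) (if γ = o then 1 else 0))
    (hm : ∀ (k : ℕ) (γ : Fin k → Γ), Summable fun τ => p τ * ∏ j, φ (γ j) τ)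
    (b : Fin n → (Γ →₀ ℕ)) :
    Summable fun t => W t * ∏ j, poissonChaos lam φ o (b j) t := by
  induction h : ∑ j, (b j).degree using Nat.strong_induction_on generalizing b with
  | _ N ih =>
  subst h
  by_cases hb : ∀ i, b i = 0
  · simpa [hb, poissonChaos_zero_left] using hW1
  · push Not at hb
    obtain ⟨i, hi⟩ := hb
    obtain ⟨γ, hγ⟩ := Finsupp.support_nonempty_iff.mpr hi
    have hbi := (Finsupp.sub_add_single_of_mem_support hγ).symm
    refine (hasSum_prod_poissonChaos hW hφo hφ hm b i _ γ hbi fun q => ?_).summable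
    refine ih _ (sum_degree_removeTuple_lt b i ?_ q) _ rfl
    conv_rhs => rw [hbi]
    simp

end Moments

/-! ### Recursion for the Hermite linearization coefficients -/

section Hermite

variable {n : ℕ}

/-- The quadratic form `∑_{i < j} x_i x_j`. -/
noncomputable def pairSum (n : ℕ) : MvPowerSeries (Fin n) ℝ :=
  ∑ i : Fin n, ∑ j ∈ Finset.Ioi i, (MvPowerSeries.X i * MvPowerSeries.X j)

theorem hasSubst_pairSum (n : ℕ) : PowerSeries.HasSubst (pairSum n) :=
  PowerSeries.HasSubst.of_constantCoeff_zero (by simp [pairSum])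

theorem pderiv_pairSum (i : Fin n) :
    MvPowerSeries.pderiv ℝ i (pairSum n) = ∑ j ∈ Finset.univ.erase i, MvPowerSeries.X j := by
  have h : ∀ k l : Fin n, k < l → MvPowerSeries.pderiv ℝ i
      (MvPowerSeries.X k * MvPowerSeries.X l : MvPowerSeries (Fin n) ℝ) =
      (if l = i then MvPowerSeries.X k else 0) + if k = i then MvPowerSeries.X l else 0 := by
    intro k l _
    rw [Derivation.leibniz, MvPowerSeries.pderiv_X, MvPowerSeries.pderiv_X, Pi.single_apply,
      Pi.single_apply]
    split_ifs <;> simp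
  have h1 : MvPowerSeries.pderiv ℝ i (pairSum n) = ∑ k : Fin n, ∑ l ∈ Finset.Ioi k,
      ((if l = i then MvPowerSeries.X k else 0) + if k = i then MvPowerSeries.X l else 0) := by
    rw [pairSum, map_sum]
    refine Finset.sum_congr rfl fun k _ => ?_
    rw [map_sum]
    exact Finset.sum_congr rfl fun l hl => h k l (Finset.mem_Ioi.mp hl)
  rw [h1]
  simp only [Finset.sum_add_distrib, Finset.sum_ite_eq', Finset.mem_Ioi]
  have h2 : ∀ k : Fin n, (∑ l ∈ Finset.Ioi k, if k = i then
      (MvPowerSeries.X l : MvPowerSeries (Fin n) ℝ) else 0) =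
      if k = i then ∑ l ∈ Finset.Ioi i, MvPowerSeries.X l else 0 := by
    intro k
    split_ifs with hk
    · rw [hk]
    · simp
  rw [Finset.sum_congr rfl fun k _ => h2 k, Finset.sum_ite_eq', if_pos (Finset.mem_univ _),
    ← Finset.sum_filter, ← Finset.sum_union]
  · refine Finset.sum_congr ?_ fun _ _ => rfl
    ext j
    simp [lt_or_lt_iff_ne]
  · rw [Finset.disjoint_left]
    intro j hj hj'
    simp only [Finset.mem_filter, Finset.mem_univ, true_and, Finset.mem_Ioi] at hj hj'
    exact lt_asymm hj hj'

/-- Each coefficient of the substituted exponential involves finitely many powers, so it can be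
computed from a partial sum. The differential equation of the exponential then follows from the
power rule alone. -/
theorem exists_coeff_expPairs_eq (m : Fin n →₀ ℕ) : ∃ N₀, ∀ N ≥ N₀,
    MvPowerSeries.coeff m (expPairs n) =
      ∑ k ∈ Finset.range N, (k.factorial : ℝ)⁻¹ * MvPowerSeries.coeff m (pairSum n ^ k) := by
  have hfin := PowerSeries.coeff_subst_finite (hasSubst_pairSum n) (PowerSeries.exp ℝ) m
  obtain ⟨N₀, hN₀⟩ := hfin.bddAbove
  refine ⟨N₀ + 1, fun N hN => ?_⟩
  have h : MvPowerSeries.coeff m (expPairs n) = finsum (fun d : ℕ =>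
      PowerSeries.coeff d (PowerSeries.exp ℝ) • MvPowerSeries.coeff m (pairSum n ^ d)) :=
    PowerSeries.coeff_subst (hasSubst_pairSum n) _ _
  rw [h, finsum_eq_sum_of_support_subset (s := Finset.range N)]
  · refine Finset.sum_congr rfl fun k _ => ?_
    simp [PowerSeries.coeff_exp]
  · intro d hd
    have := hN₀ hd
    simp only [Finset.coe_range, Set.mem_Iio]
    omega

/-- This is the coefficient form of `∂_i exp Q = (∑_{j ≠ i} x_j) exp Q` for `Q = ∑_{i<j} x_i x_j`.
-/
theorem coeff_expPairs_add_single (m : Fin n →₀ ℕ) (i : Fin n) :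
    MvPowerSeries.coeff (m + Finsupp.single i 1) (expPairs n) * (m i + 1) =
      ∑ j ∈ Finset.univ.erase i, if m j = 0 then 0 else
        MvPowerSeries.coeff (m - Finsupp.single j 1) (expPairs n) := by
  obtain ⟨N₁, hN₁⟩ := exists_coeff_expPairs_eq (m + Finsupp.single i 1)
  choose N hN using fun j : Fin n => exists_coeff_expPairs_eq (m - Finsupp.single j 1)
  set K := N₁ + ∑ j, N j with hK
  have hKj : ∀ j, N j ≤ K := fun j =>
    (Finset.single_le_sum (f := N) (fun _ _ => Nat.zero_le _) (Finset.mem_univ j)).trans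
      (Nat.le_add_left _ _)
  -- Differentiation lowers the power of `pairSum n` by one, so the left side needs one more term
  -- than the right; its zeroth term vanishes because the monomial is not constant.
  rw [hN₁ (K + 1) (by omega)]
  simp only [hN _ K (hKj _)]
  have hX : ∀ (j : Fin n) (F : MvPowerSeries (Fin n) ℝ),
      MvPowerSeries.coeff m (MvPowerSeries.X j * F) =
        if m j = 0 then 0 else MvPowerSeries.coeff (m - Finsupp.single j 1) F := by
    intro j F
    rw [MvPowerSeries.X, MvPowerSeries.coeff_monomial_mul, one_mul]
    by_cases h : m j = 0
    · rw [if_neg, if_pos h]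
      rw [Finsupp.single_le_iff]
      omega
    · rw [if_pos, if_neg h]
      rw [Finsupp.single_le_iff]
      omega
  have hd : ∀ k : ℕ, MvPowerSeries.coeff (m + Finsupp.single i 1) (pairSum n ^ (k + 1)) *
      (m i + 1) = (k + 1) * ∑ j ∈ Finset.univ.erase i,
        if m j = 0 then 0 else MvPowerSeries.coeff (m - Finsupp.single j 1) (pairSum n ^ k) := by
    intro k
    rw [← MvPowerSeries.coeff_pderiv, MvPowerSeries.pderiv_pow, pderiv_pairSum, add_tsub_cancel_right,
      mul_assoc, ← nsmul_eq_mul, map_nsmul, mul_comm (pairSum n ^ k), Finset.sum_mul, map_sum,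
      nsmul_eq_mul]
    simp only [hX]
    push_cast
    rfl
  have h0 : MvPowerSeries.coeff (m + Finsupp.single i 1) (pairSum n ^ 0) = 0 := by
    classical
    rw [pow_zero, MvPowerSeries.coeff_one, if_neg]
    intro h
    simpa using DFunLike.congr_fun h i
  rw [Finset.sum_range_succ', h0, mul_zero, add_zero, Finset.sum_mul]
  have hk : ∀ k : ℕ, ((k + 1).factorial : ℝ)⁻¹ *
      MvPowerSeries.coeff (m + Finsupp.single i 1) (pairSum n ^ (k + 1)) * (m i + 1) =
      ∑ j ∈ Finset.univ.erase i, if m j = 0 then 0 else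
        (k.factorial : ℝ)⁻¹ * MvPowerSeries.coeff (m - Finsupp.single j 1) (pairSum n ^ k) := by
    intro k
    rw [mul_assoc, hd, ← mul_assoc, Nat.factorial_succ, Finset.mul_sum]
    refine Finset.sum_congr rfl fun j _ => ?_
    have h1 : (k : ℝ) + 1 ≠ 0 := by positivity
    split_ifs
    · simp
    · push_cast
      field_simp
  rw [Finset.sum_congr rfl fun k _ => hk k, Finset.sum_comm]
  refine Finset.sum_congr rfl fun j _ => ?_
  split_ifs
  · simp
  · rfl

theorem hermiteCoeff_zero : hermiteCoeff (fun _ : Fin n => 0) = 1 := by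
  have : (Finsupp.equivFunOnFinite.symm fun _ : Fin n => 0) = 0 := by
    ext
    simp
  rw [hermiteCoeff, this]
  obtain ⟨N₀, hN₀⟩ := exists_coeff_expPairs_eq (0 : Fin n →₀ ℕ)
  rw [hN₀ (N₀ + 1) (by omega), Finset.sum_eq_single 0]
  · simp
  · intro k _ hk
    rw [MvPowerSeries.coeff_zero_eq_constantCoeff_apply, map_pow]
    simp [pairSum, zero_pow hk]
  · simp

/-- Recursion for the Hermite linearization coefficients. -/
theorem sqrt_mul_hermiteCoeff (m : Fin n → ℕ) (i : Fin n) (k : ℕ) (hk : m i = k + 1) :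
    √(k + 1) * hermiteCoeff m = ∑ j, √(Function.update m i 0 j) *
      hermiteCoeff (Function.update (Function.update (Function.update m i 0) j
        (Function.update m i 0 j - 1)) i k) := by
  set M : Fin n → ℕ := Function.update m i k with hM
  have hMi : M i = k := by simp [hM]
  have hm1 : Finsupp.equivFunOnFinite.symm m =
      Finsupp.equivFunOnFinite.symm M + Finsupp.single i 1 := by
    ext j
    by_cases h : j = i
    · subst h
      simp [hMi, hk]
    · simp [hM, Function.update_of_ne h, Finsupp.single_eq_of_ne h]
  have hfac : ∏ j, ((m j).factorial : ℝ) = (k + 1) * ∏ j, ((M j).factorial : ℝ) := by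
    rw [← Finset.mul_prod_erase _ _ (Finset.mem_univ i),
      ← Finset.mul_prod_erase _ (fun j => ((M j).factorial : ℝ)) (Finset.mem_univ i), hMi, hk,
      Nat.factorial_succ, Finset.prod_congr (g := fun j => ((M j).factorial : ℝ)) rfl fun j hj => by
        rw [hM, Function.update_of_ne (Finset.ne_of_mem_erase hj)]]
    push_cast
    ring
  have hrec : MvPowerSeries.coeff (Finsupp.equivFunOnFinite.symm m) (expPairs n) * (k + 1) =
      ∑ j ∈ Finset.univ.erase i, if M j = 0 then 0 else MvPowerSeries.coeff
        (Finsupp.equivFunOnFinite.symm M - Finsupp.single j 1) (expPairs n) := by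
    have h := coeff_expPairs_add_single (Finsupp.equivFunOnFinite.symm M) i
    rw [← hm1] at h
    rw [← hMi]
    exact h
  have hsq : √((k : ℝ) + 1) * √((k : ℝ) + 1) = k + 1 := Real.mul_self_sqrt (by positivity)
  rw [hermiteCoeff, hfac, Real.sqrt_mul (by positivity)]
  have : √((k : ℝ) + 1) * (√((k : ℝ) + 1) * √(∏ j, ((M j).factorial : ℝ)) *
      MvPowerSeries.coeff (Finsupp.equivFunOnFinite.symm m) (expPairs n)) =
      √(∏ j, ((M j).factorial : ℝ)) * (MvPowerSeries.coeff (Finsupp.equivFunOnFinite.symm m)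
        (expPairs n) * (k + 1)) := by
    linear_combination (√(∏ j, ((M j).factorial : ℝ)) *
      MvPowerSeries.coeff (Finsupp.equivFunOnFinite.symm m) (expPairs n)) * hsq
  -- The term `j = i` in the sum over all `j` carries `√0`, since position `i` has been emptied.
  rw [this, hrec, ← Finset.add_sum_erase _ _ (Finset.mem_univ i)]
  simp only [Function.update_self, Nat.cast_zero, Real.sqrt_zero, zero_mul, zero_add,
    Finset.mul_sum]
  refine Finset.sum_congr rfl fun j hj => ?_
  have hji := Finset.ne_of_mem_erase hj
  have hMj : M j = m j := by simp [hM, Function.update_of_ne hji]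
  rw [Function.update_of_ne hji]
  by_cases h0 : m j = 0
  · simp [h0, hMj]
  rw [if_neg (by rwa [hMj])]
  have hup : Function.update (Function.update (Function.update m i 0) j (m j - 1)) i k =
      Function.update M j (m j - 1) := by
    rw [Function.update_comm hji, Function.update_idem, hM]
  have hfs : Finsupp.equivFunOnFinite.symm (Function.update M j (m j - 1)) =
      Finsupp.equivFunOnFinite.symm M - Finsupp.single j 1 := by
    ext l
    by_cases h : l = j
    · subst h
      simp [hMj]
    · simp [Function.update_of_ne h, Finsupp.single_eq_of_ne h]
  have hfac2 : ∏ l, ((M l).factorial : ℝ) =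
      m j * ∏ l, ((Function.update M j (m j - 1) l).factorial : ℝ) := by
    rw [← Finset.mul_prod_erase _ _ (Finset.mem_univ j), ← Finset.mul_prod_erase _
      (fun l => ((Function.update M j (m j - 1) l).factorial : ℝ)) (Finset.mem_univ j), hMj,
      Function.update_self, Finset.prod_congr rfl fun l hl => by
        rw [← Function.update_of_ne (Finset.ne_of_mem_erase hl) (m j - 1) M]]
    rw [← Nat.mul_factorial_pred h0]
    push_cast
    ring
  rw [hup, hermiteCoeff, hfs, hfac2, Real.sqrt_mul (by positivity)]
  ring

end Hermite

/-! ### Limit of the moments as the mean degree tends to infinity -/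

section Limit

variable {Γ X : Type*} {n : ℕ}

/-- The limit of the moments of the chaos functions: a product of Hermite coefficients. -/
noncomputable def hermiteProd (b : Fin n → (Γ →₀ ℕ)) : ℝ :=
  ∏ᶠ γ, hermiteCoeff fun i => b i γ

theorem hermiteProd_eq_prod (b : Fin n → (Γ →₀ ℕ)) (S : Finset Γ)
    (hS : ∀ i, (b i).support ⊆ S) :
    hermiteProd b = ∏ γ ∈ S, hermiteCoeff fun i => b i γ := by
  refine finprod_eq_prod_of_mulSupport_subset _ fun γ hγ => ?_
  by_contra h
  refine hγ ?_
  have : (fun i => b i γ) = fun _ => 0 := by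
    ext i
    exact Finsupp.notMem_support_iff.mp fun hi => h (hS i hi)
  dsimp only
  rw [this, hermiteCoeff_zero]

/-- Removing `γ` changes only the factor at `γ`, so the one-variable recursion applies there and all
other factors are carried along. -/
theorem sqrt_mul_hermiteProd (b : Fin n → (Γ →₀ ℕ)) (i : Fin n) (β : Γ →₀ ℕ) (γ : Γ)
    (hb : b i = β + Finsupp.single γ 1) :
    √(β γ + 1) * hermiteProd b = ∑ j, √(Function.update b i 0 j γ) * hermiteProd
      (Function.update (Function.update (Function.update b i 0) j
        (Function.update b i 0 j - Finsupp.single γ 1)) i β) := by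
  classical
  set S : Finset Γ := Finset.univ.biUnion fun j => (b j).support with hS
  have hbS : ∀ j, (b j).support ⊆ S := fun j =>
    Finset.subset_biUnion_of_mem (fun j => (b j).support) (Finset.mem_univ j)
  have hγS : γ ∈ S := hbS i (by simp [hb])
  have hβS : β.support ⊆ S := by
    refine subset_trans ?_ (hbS i)
    rw [hb]
    exact Finsupp.support_mono le_self_add
  have key : ∀ j, (Function.update (Function.update (Function.update b i 0) j
        (Function.update b i 0 j - Finsupp.single γ 1)) i β) = fun l =>
      if l = i then β else if l = j then b l - Finsupp.single γ 1 else b l := by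
    intro j
    ext l : 1
    by_cases hli : l = i
    · subst hli
      simp
    · by_cases hlj : l = j
      · subst hlj
        simp [hli]
      · simp [hli, hlj]
  rw [hermiteProd_eq_prod b S hbS, ← Finset.mul_prod_erase _ _ hγS, ← mul_assoc,
    sqrt_mul_hermiteCoeff (fun j => b j γ) i (β γ) (by simp [hb]), Finset.sum_mul]
  refine Finset.sum_congr rfl fun j _ => ?_
  rw [key, hermiteProd_eq_prod _ S (by
    intro l
    split_ifs
    · exact hβS
    · exact (Finsupp.support_mono tsub_le_self).trans (hbS l)
    · exact hbS l), ← Finset.mul_prod_erase _ _ hγS, mul_assoc]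
  congr 1
  · by_cases hji : j = i
    · subst hji
      simp
    · simp [hji]
  congr 1
  · congr 1
    ext l
    by_cases hli : l = i
    · subst hli
      simp
    · by_cases hlj : l = j
      · subst hlj
        simp [hli]
      · simp [hli, hlj]
  · refine Finset.prod_congr rfl fun γ' hγ' => ?_
    have hne := Finset.ne_of_mem_erase hγ'
    congr 1
    ext l
    by_cases hli : l = i
    · subst hli
      simp [hb, Finsupp.single_eq_of_ne hne]
    · by_cases hlj : l = j
      · subst hlj
        simp [hli, Finsupp.single_eq_of_ne hne]
      · simp [hli, hlj]

/-- Removing a single point `γ` in position `j`. -/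
noncomputable def removeSingle (j : Fin n) (γ : Γ) : Fin n → Option Γ :=
  Function.update (fun _ => none) j (some γ)

theorem removeSingle_injective {j j' : Fin n} {γ γ' : Γ}
    (h : removeSingle j γ = removeSingle j' γ') : j = j' ∧ γ = γ' := by
  have h1 := congrFun h j
  by_cases hj : j = j'
  · subst hj
    simpa [removeSingle] using h1
  · simp [removeSingle, Function.update_of_ne hj] at h1

theorem removeTuple_removeSingle (b : Fin n → (Γ →₀ ℕ)) (i : Fin n) (β : Γ →₀ ℕ) (j : Fin n)
    (γ : Γ) : removeTuple b i β (removeSingle j γ) =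
      Function.update (Function.update (Function.update b i 0) j
        (Function.update b i 0 j - Finsupp.single γ 1)) i β := by
  rw [removeTuple]
  congr 1
  ext l : 1
  by_cases hlj : l = j
  · subst hlj
    simp [removeSingle, removePoint]
  · simp [removeSingle, removePoint, hlj]

theorem prod_removeCoeff_removeSingle (lam : ℝ) (b : Fin n → (Γ →₀ ℕ)) (j : Fin n) (γ : Γ) :
    ∏ l, removeCoeff lam (b l) (removeSingle j γ l) = √(b j γ) / √lam := by
  rw [Finset.prod_eq_single j]
  · simp [removeSingle, removeCoeff]
  · intro l _ hl
    simp [removeSingle, removeCoeff, hl]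
  · simp

/-- The first removal cancels `√lam`, the second one tends to zero like `(√lam)⁻¹`, and every other
factor has a finite limit. -/
theorem tendsto_sqrt_mul_prod_removeCoeff (b : Fin n → (Γ →₀ ℕ)) (q : Fin n → Option Γ)
    {j j' : Fin n} (hjj : j ≠ j') (hj : q j ≠ none) (hj' : q j' ≠ none) :
    Tendsto (fun lam => √lam * ∏ l, removeCoeff lam (b l) (q l)) atTop (𝓝 0) := by
  classical
  have hinv : Tendsto (fun lam : ℝ => (√lam)⁻¹) atTop (𝓝 0) :=
    tendsto_inv_atTop_zero.comp Real.tendsto_sqrt_atTop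
  have hlim : ∀ l, ∃ c, Tendsto (fun lam => removeCoeff lam (b l) (q l)) atTop (𝓝 c) := by
    intro l
    cases q l with
    | none => exact ⟨1, tendsto_const_nhds⟩
    | some γ => exact ⟨_, (hinv.const_mul (√(b l γ)))⟩
  choose c hc using hlim
  have hj0 : Tendsto (fun lam => √lam * removeCoeff lam (b j) (q j)) atTop
      (𝓝 (√(b j ((q j).get (Option.isSome_iff_ne_none.mpr hj))))) := by
    obtain ⟨γ, hγ⟩ := Option.ne_none_iff_exists'.mp hj
    refine tendsto_const_nhds.congr' ?_
    filter_upwards [eventually_gt_atTop 0] with lam hlam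
    have : √lam ≠ 0 := (Real.sqrt_pos.mpr hlam).ne'
    simp only [hγ, removeCoeff, Option.get_some]
    field_simp
  have hj'0 : Tendsto (fun lam => removeCoeff lam (b j') (q j')) atTop (𝓝 0) := by
    obtain ⟨γ, hγ⟩ := Option.ne_none_iff_exists'.mp hj'
    simpa [hγ, removeCoeff, div_eq_mul_inv] using hinv.const_mul (√(b j' γ))
  have hmem : j' ∈ Finset.univ.erase j := by simp [hjj.symm]
  have := (hj0.mul (hj'0.mul (tendsto_finsetProd ((Finset.univ.erase j).erase j')
    fun l _ => hc l)))
  rw [zero_mul, mul_zero] at this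
  refine this.congr fun lam => ?_
  rw [Finset.mul_prod_erase _ (fun l => removeCoeff lam (b l) (q l)) hmem, mul_assoc,
    Finset.mul_prod_erase _ (fun l => removeCoeff lam (b l) (q l)) (Finset.mem_univ j)]

variable {φ : ℝ → Γ → X → ℝ} {o : Γ} {W : ℝ → (X →₀ ℕ) → ℝ} {p : ℝ → X → ℝ}

open Classical in
/-- The moments of the Poisson chaos functions converge to those of Hermite polynomials. -/
theorem tendsto_tsum_prod_poissonChaos
    (hW : ∀ lam, 0 < lam → ∀ t τ,
      W lam (t + Finsupp.single τ 1) * (t τ + 1) = lam * p lam τ * W lam t)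
    (hW1 : ∀ lam, 0 < lam → HasSum (W lam) 1) (hφo : ∀ lam, 0 < lam → ∀ τ, φ lam o τ = 1)
    (hφ : ∀ lam, 0 < lam → ∀ γ γ', HasSum (fun τ => p lam τ * φ lam γ τ * φ lam γ' τ)
      (if γ = γ' then 1 else 0))
    (hm : ∀ lam, 0 < lam → ∀ (k : ℕ) (γ : Fin k → Γ),
      Summable fun τ => p lam τ * ∏ j, φ lam (γ j) τ)
    (hlim : ∀ (k : ℕ) (γ : Fin k → Γ), ∃ l,
      Tendsto (fun lam => ∑' τ, p lam τ * ∏ j, φ lam (γ j) τ) atTop (𝓝 l))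
    (b : Fin n → (Γ →₀ ℕ)) :
    Tendsto (fun lam => ∑' t, W lam t * ∏ j, poissonChaos lam (φ lam) o (b j) t) atTop
      (𝓝 (hermiteProd b)) := by
  have hφ1 : ∀ lam, 0 < lam → ∀ γ,
      HasSum (fun τ => p lam τ * φ lam γ τ) (if γ = o then 1 else 0) := by
    intro lam hlam γ
    simpa [hφo lam hlam] using hφ lam hlam γ o
  induction h : ∑ j, (b j).degree using Nat.strong_induction_on generalizing b with
  | _ N ih =>
  subst h
  by_cases hb : ∀ i, b i = 0
  · have h1 : hermiteProd b = 1 := by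
      rw [hermiteProd_eq_prod b ∅ (by simp [hb])]
      simp
    rw [h1]
    refine tendsto_const_nhds.congr' ?_
    filter_upwards [eventually_gt_atTop 0] with lam hlam
    simp [hb, poissonChaos_zero_left, (hW1 lam hlam).tsum_eq]
  push Not at hb
  obtain ⟨i, hi⟩ := hb
  obtain ⟨γ, hγ⟩ := Finsupp.support_nonempty_iff.mpr hi
  obtain ⟨β, hβ⟩ : ∃ β, b i = β + Finsupp.single γ 1 :=
    ⟨_, (Finsupp.sub_add_single_of_mem_support hγ).symm⟩
  have hpos : √((β γ : ℝ) + 1) ≠ 0 := (Real.sqrt_pos.mpr (by positivity)).ne'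
  have ih' : ∀ q, Tendsto (fun lam => ∑' t, W lam t * ∏ j, poissonChaos lam (φ lam) o
      (removeTuple b i β q j) t) atTop (𝓝 (hermiteProd (removeTuple b i β q))) := fun q =>
    ih _ (sum_degree_removeTuple_lt b i (by simp [hβ]) q) _ rfl
  -- `T j` is the limiting contribution of the choice that removes the same `γ` at position `j`
  -- only.
  set T : Fin n → ℝ := fun j => √(Function.update b i 0 j γ) *
    hermiteProd (removeTuple b i β (removeSingle j γ)) with hT
  have hterm : ∀ q ∈ (removeChoices b i).erase (fun _ => none),
      Tendsto (fun lam => (√lam * ∏ j, removeCoeff lam (Function.update b i 0 j) (q j)) *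
        (∑' τ, p lam τ * ∏ j, φ lam (Fin.cons (α := fun _ => Γ) γ (fun j => (q j).getD o) j) τ) *
        ∑' t, W lam t * ∏ j, poissonChaos lam (φ lam) o (removeTuple b i β q j) t) atTop
        (𝓝 (∑ j, if q = removeSingle j γ then T j else 0)) := by
    intro q hq
    have hq0 : q ≠ fun _ => none := Finset.ne_of_mem_erase hq
    obtain ⟨j, hj⟩ := Function.ne_iff.mp hq0
    obtain ⟨γ', hγ'⟩ := Option.ne_none_iff_exists'.mp hj
    -- With exactly one removal the powers of `lam` cancel and the remaining moment of the `φ` is an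
    -- inner product, which is `0` or `1`. With at least two, the prefactor tends to zero and only
    -- the existence of a limit from `hlim` is needed.
    by_cases hq1 : ∀ l, l ≠ j → q l = none
    · have hqs : q = removeSingle j γ' := by
        ext l : 1
        by_cases hl : l = j
        · subst hl
          simp [removeSingle, hγ']
        · simp [removeSingle, hl, hq1 l hl]
      have hL : (∑ j, if q = removeSingle j γ then T j else 0) =
          √(Function.update b i 0 j γ') * (if γ = γ' then 1 else 0) *
            hermiteProd (removeTuple b i β q) := by
        rw [Finset.sum_eq_single j]
        · by_cases h : γ = γ'
          · subst h
            rw [if_pos hqs, if_pos rfl, hT, hqs, mul_one]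
          · rw [if_neg, if_neg h]
            · simp
            · intro h'
              exact h (removeSingle_injective (hqs.symm.trans h')).2.symm
        · intro l _ hl
          rw [if_neg]
          intro h'
          exact hl (removeSingle_injective (hqs.symm.trans h')).1.symm
        · simp
      rw [hL]
      refine ((ih' q).const_mul _).congr' ?_
      filter_upwards [eventually_gt_atTop 0] with lam hlam
      have hc : √lam ≠ 0 := (Real.sqrt_pos.mpr hlam).ne'
      have h1 : ∏ j, removeCoeff lam (Function.update b i 0 j) (q j) =
          √(Function.update b i 0 j γ') / √lam := by
        rw [hqs]
        exact prod_removeCoeff_removeSingle lam _ j γ'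
      have h2 : (∑' τ, p lam τ * ∏ j, φ lam (Fin.cons (α := fun _ => Γ) γ
          (fun j => (q j).getD o) j) τ) = if γ = γ' then 1 else 0 := by
        rw [← (hφ lam hlam γ γ').tsum_eq]
        refine tsum_congr fun τ => ?_
        rw [Fin.prod_univ_succ, Fin.cons_zero, mul_assoc]
        congr 2
        rw [Finset.prod_eq_single j]
        · simp [hγ']
        · intro l _ hl
          simp [hq1 l hl, hφo lam hlam]
        · simp
      rw [h1, h2]
      field_simp
    · push Not at hq1
      obtain ⟨l, hlj, hl⟩ := hq1
      have hL : (∑ j, if q = removeSingle j γ then T j else 0) = 0 := by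
        refine Finset.sum_eq_zero fun k _ => if_neg ?_
        rintro rfl
        have h1 : ∀ m, removeSingle k γ m ≠ none → m = k := by
          intro m hm'
          by_contra hne
          simp [removeSingle, hne] at hm'
        exact hlj ((h1 l hl).trans (h1 j hj).symm)
      rw [hL]
      obtain ⟨c, hc⟩ := hlim _ (Fin.cons (α := fun _ => Γ) γ (fun j => (q j).getD o))
      have := ((tendsto_sqrt_mul_prod_removeCoeff (Function.update b i 0) q hlj hl hj).mul hc).mul
        (ih' q)
      rwa [zero_mul, zero_mul] at this
  have hall := (tendsto_finsetSum _ hterm).const_mul (√((β γ : ℝ) + 1))⁻¹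
  have hval : (√((β γ : ℝ) + 1))⁻¹ * ∑ q ∈ (removeChoices b i).erase (fun _ => none),
      (∑ j, if q = removeSingle j γ then T j else 0) = hermiteProd b := by
    rw [inv_mul_eq_iff_eq_mul₀ hpos, sqrt_mul_hermiteProd b i β γ hβ, Finset.sum_comm]
    refine Finset.sum_congr rfl fun j _ => ?_
    rw [Finset.sum_ite_eq']
    split_ifs with hmem
    · rw [hT]
      simp only [removeTuple_removeSingle]
    -- If removing `γ` at `j` is not an admissible choice, then `γ` has multiplicity zero there and
    -- the Hermite term vanishes as well.
    · have : Function.update b i 0 j γ = 0 := by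
        by_contra h0
        refine hmem (Finset.mem_erase.mpr ⟨?_, ?_⟩)
        · intro h'
          simpa [removeSingle] using congrFun h' j
        · rw [removeChoices, Fintype.mem_piFinset]
          intro l
          by_cases hl : l = j
          · subst hl
            simpa [removeSingle] using h0
          · simp [removeSingle, hl]
      rw [this]
      simp
  rw [hval] at hall
  refine hall.congr' ?_
  filter_upwards [eventually_gt_atTop 0] with lam hlam
  exact (hasSum_prod_poissonChaos (hW lam hlam) (hφo lam hlam) (hφ1 lam hlam) (hm lam hlam) b i β γ
    hβ fun q => summable_prod_poissonChaos (hW lam hlam) (hW1 lam hlam).summable (hφo lam hlam)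
      (hφ1 lam hlam) (hm lam hlam) _).tsum_eq.symm

end Limit

/-! ### Families of independent Poisson variables as atomic measures -/

section PoissonWeight

variable {ι : Type}

/-- The mass that the law of a family of independent Poisson variables gives to a finitely
supported configuration. -/
noncomputable def poissonWeight (r : ι → ℝ) (t : ι →₀ ℕ) : ℝ :=
  Real.exp (-∑' i, r i) * t.prod fun i n => r i ^ n / (n.factorial : ℝ)

theorem poissonWeight_zero (r : ι → ℝ) : poissonWeight r 0 = Real.exp (-∑' i, r i) := by
  simp [poissonWeight]

theorem poissonWeight_nonneg {r : ι → ℝ} (hr : ∀ i, 0 ≤ r i) (t : ι →₀ ℕ) :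
    0 ≤ poissonWeight r t :=
  mul_nonneg (Real.exp_pos _).le (Finset.prod_nonneg fun i _ =>
    div_nonneg (pow_nonneg (hr i) _) (Nat.cast_nonneg _))

theorem poissonWeight_pos {r : ι → ℝ} (hr : ∀ i, 0 < r i) (t : ι →₀ ℕ) :
    0 < poissonWeight r t :=
  mul_pos (Real.exp_pos _) (Finset.prod_pos fun i _ =>
    div_pos (pow_pos (hr i) _) (Nat.cast_pos.mpr (Nat.factorial_pos _)))

theorem poissonWeight_add_single (r : ι → ℝ) (t : ι →₀ ℕ) (i : ι) :
    poissonWeight r (t + Finsupp.single i 1) * (t i + 1) = r i * poissonWeight r t := by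
  have h := congrArg (MvPowerSeries.coeff t) (pderiv_expLinearForm r i)
  rw [MvPowerSeries.coeff_pderiv, MvPowerSeries.coeff_C_mul] at h
  change expLinearForm r (t + Finsupp.single i 1) * _ = r i * expLinearForm r t at h
  unfold expLinearForm at h
  unfold poissonWeight
  linear_combination Real.exp (-∑' i, r i) * h

theorem poissonMeasure_toNNReal_singleton {r : ℝ} (hr : 0 ≤ r) (n : ℕ) :
    poissonMeasure r.toNNReal {n} =
      ENNReal.ofReal (Real.exp (-r) * (r ^ n / (n.factorial : ℝ))) := by
  rw [poissonMeasure_singleton, Real.coe_toNNReal r hr, mul_div_assoc]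

variable [Countable ι] {r : ι → ℝ}

/-- The product of the factors `exp (-r i)` converges because the rates are summable; the remaining
factors equal `1` off the support of `t`. -/
theorem poissonFamily_singleton (hr : ∀ i, 0 ≤ r i) (hs : Summable r) (t : ι →₀ ℕ) :
    poissonFamily r {⇑t} = ENNReal.ofReal (poissonWeight r t) := by
  have h1 : HasProd (fun i => Real.exp (-r i) * (r i ^ t i / ((t i).factorial : ℝ)))
      (poissonWeight r t) := by
    refine HasProd.mul hs.hasSum.neg.rexp (hasProd_prod_of_ne_finset_one (s := t.support) ?_)
    intro i hi
    simp [Finsupp.notMem_support_iff.mp hi]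
  rw [poissonFamily, Measure.infinitePi_singleton]
  refine HasProd.tprod_eq ?_
  refine ((ENNReal.continuous_ofReal.tendsto _).comp h1).congr fun s => ?_
  rw [Function.comp_apply, ENNReal.ofReal_prod_of_nonneg fun i _ => mul_nonneg
    (Real.exp_pos _).le (div_nonneg (pow_nonneg (hr i) _) (Nat.cast_nonneg _))]
  exact Finset.prod_congr rfl fun i _ => (poissonMeasure_toNNReal_singleton (hr i) _).symm

/-- Borel-Cantelli: a coordinate is nonzero with probability `1 - exp (-r i) ≤ r i`, which is
summable. -/
theorem poissonFamily_ae_finite (hr : ∀ i, 0 ≤ r i) (hs : Summable r) :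
    ∀ᵐ N ∂(poissonFamily r), N ∈ Set.range (fun t : ι →₀ ℕ => ⇑t) := by
  have hle : ∀ i, poissonFamily r {N | N i ≠ 0} ≤ ENNReal.ofReal (r i) := by
    intro i
    have h1 : poissonFamily r {N | N i ≠ 0} = poissonMeasure (r i).toNNReal {0}ᶜ :=
      (measurePreserving_eval_infinitePi (fun i => poissonMeasure (r i).toNNReal) i).measure_preimage
        (MeasurableSet.of_discrete (s := ({0}ᶜ : Set ℕ))).nullMeasurableSet
    rw [h1, prob_compl_eq_one_sub (MeasurableSet.of_discrete), poissonMeasure_toNNReal_singleton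
      (hr i), ← ENNReal.ofReal_one, ← ENNReal.ofReal_sub _ (by positivity)]
    refine ENNReal.ofReal_le_ofReal ?_
    have := Real.add_one_le_exp (-r i)
    simp
    linarith
  have hsum : ∑' i, poissonFamily r {N | N i ≠ 0} ≠ ⊤ := by
    refine ne_top_of_le_ne_top ?_ (ENNReal.tsum_le_tsum hle)
    rw [← ENNReal.ofReal_tsum_of_nonneg hr hs]
    exact ENNReal.ofReal_ne_top
  filter_upwards [ae_finite_setOfPred_mem hsum] with N hN
  exact ⟨Finsupp.ofSupportFinite N hN, rfl⟩

theorem poissonFamily_eq_sum (hr : ∀ i, 0 ≤ r i) (hs : Summable r) :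
    poissonFamily r = Measure.sum fun t : ι →₀ ℕ =>
      ENNReal.ofReal (poissonWeight r t) • Measure.dirac (⇑t) := by
  have h1 : Set.range (fun t : ι →₀ ℕ => ⇑t) = ⋃ t : ι →₀ ℕ, {⇑t} := by
    ext N
    simp [eq_comm]
  rw [← Measure.restrict_eq_self_of_ae_mem (poissonFamily_ae_finite hr hs), h1,
    Measure.restrict_iUnion]
  · congr 1
    ext1 t
    rw [Measure.restrict_singleton, poissonFamily_singleton hr hs]
  · intro t t' h
    simpa [Function.onFun] using fun h' => h h'
  · intro t
    exact MeasurableSet.singleton _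

theorem hasSum_poissonWeight (hr : ∀ i, 0 ≤ r i) (hs : Summable r) :
    HasSum (poissonWeight r) 1 := by
  have h1 : poissonFamily r Set.univ = 1 := by
    rw [poissonFamily, measure_univ]
  rw [poissonFamily_eq_sum hr hs, Measure.sum_apply _ MeasurableSet.univ] at h1
  simp only [Measure.smul_apply, measure_univ, smul_eq_mul, mul_one] at h1
  have h2 : Summable (poissonWeight r) := by
    have := ENNReal.summable_toReal (f := fun t => ENNReal.ofReal (poissonWeight r t))
      (by rw [h1]; exact ENNReal.one_ne_top)
    simpa only [ENNReal.toReal_ofReal (poissonWeight_nonneg hr _)] using this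
  rw [← ENNReal.ofReal_tsum_of_nonneg (poissonWeight_nonneg hr) h2, ENNReal.ofReal_eq_one] at h1
  exact h1 ▸ h2.hasSum

/-- For atomic measures `F` needs no measurability assumption. This is what allows pushing forward
along `RTree.ofMult` and `correlatedPair`, defined on uncountable products. -/
theorem map_sum_smul_dirac {κ α β : Type*} [Countable κ] [MeasurableSpace α]
    [MeasurableSingletonClass α] [MeasurableSpace β] [MeasurableSingletonClass β]
    (w : κ → ENNReal) (x : κ → α) (F : α → β) :
    (Measure.sum fun k => w k • Measure.dirac (x k)).map F =
      Measure.sum fun k => w k • Measure.dirac (F (x k)) := by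
  rw [Measure.map_sum]
  · congr 1
    ext1 k
    rw [Measure.map_smul, Measure.map_dirac]
  · rw [aemeasurable_sum_measure_iff]
    exact fun k => aemeasurable_dirac.smul_measure _

theorem prod_sum_smul_dirac {κ κ' α β : Type*} [Countable κ'] [MeasurableSpace α]
    [MeasurableSpace β] {w : κ → ℝ} {w' : κ' → ℝ} (hw : ∀ k, 0 ≤ w k) (x : κ → α) (y : κ' → β) :
    (Measure.sum fun k => ENNReal.ofReal (w k) • Measure.dirac (x k)).prod
      (Measure.sum fun k => ENNReal.ofReal (w' k) • Measure.dirac (y k)) =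
      Measure.sum fun k : κ × κ' =>
        ENNReal.ofReal (w k.1 * w' k.2) • Measure.dirac (x k.1, y k.2) := by
  rw [Measure.prod_sum]
  congr 1
  ext1 k
  rw [Measure.prod_smul_left, Measure.prod_smul_right, Measure.dirac_prod_dirac, smul_smul,
    ENNReal.ofReal_mul (hw _)]

open Classical in
theorem real_sum_smul_dirac_singleton {κ α : Type*} [MeasurableSpace α]
    [MeasurableSingletonClass α] {w : κ → ℝ} (hw : ∀ k, 0 ≤ w k) (x : κ → α) (a : α) :
    (Measure.sum fun k => ENNReal.ofReal (w k) • Measure.dirac (x k)).real {a} =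
      ∑' k, if x k = a then w k else 0 := by
  rw [measureReal_def, Measure.sum_apply _ (MeasurableSet.singleton a), ENNReal.tsum_toReal_eq]
  · refine tsum_congr fun k => ?_
    rw [Measure.smul_apply, Measure.dirac_apply' _ (MeasurableSet.singleton a)]
    by_cases h : x k = a
    · simp [h, ENNReal.toReal_ofReal (hw k)]
    · simp [h]
  · intro k
    rw [Measure.smul_apply, smul_eq_mul]
    exact ENNReal.mul_ne_top ENNReal.ofReal_ne_top (measure_ne_top _ _)

theorem hasSum_real_singleton {α : Type*} [Countable α] [MeasurableSpace α]
    [MeasurableSingletonClass α] (μ : Measure α) [IsProbabilityMeasure μ] :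
    HasSum (fun a => μ.real {a}) 1 := by
  have h1 : ∑' a, μ {a} = 1 := by
    have h : (Measure.sum fun a => μ {a} • Measure.dirac a) Set.univ = 1 := by
      rw [Measure.sum_smul_dirac, measure_univ]
    rw [Measure.sum_apply _ MeasurableSet.univ] at h
    simpa only [Measure.smul_apply, measure_univ, smul_eq_mul, mul_one] using h
  have h2 := (ENNReal.summable_toReal (f := fun a => μ {a}) (by rw [h1]; exact ENNReal.one_ne_top))
  have h3 := ENNReal.tsum_toReal_eq (f := fun a => μ {a}) (fun a => measure_ne_top _ _)
  rw [h1, ENNReal.toReal_one] at h3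
  have := h2.hasSum
  rwa [← h3] at this

end PoissonWeight

/-! ### Galton-Watson laws: countability of trees and point masses -/

namespace RTree

instance countable : (d : ℕ) → Countable (RTree d)
  | 0 => inferInstanceAs (Countable Unit)
  | d + 1 => by
    have := countable d
    exact inferInstanceAs (Countable (RTree d →₀ ℕ))

instance (d : ℕ) : DiscreteMeasurableSpace (RTree d) := ⟨fun _ => trivial⟩

theorem ofMult_coe {d : ℕ} (t : RTree d →₀ ℕ) : ofMult (⇑t) = ofFinsupp t := by
  have h : (Function.support (⇑t)).Finite := t.hasFiniteSupport
  rw [ofMult, dif_pos h]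
  congr 1
  ext
  rfl

end RTree

section Laws

variable {lam : ℝ} {d : ℕ}

theorem galtonWatson_succ_eq_sum (hlam : 0 ≤ lam) [IsProbabilityMeasure (galtonWatson lam d)] :
    galtonWatson lam (d + 1) = Measure.sum fun t : RTree d →₀ ℕ => ENNReal.ofReal
      (poissonWeight (fun τ => lam * (galtonWatson lam d).real {τ}) t) •
        Measure.dirac (RTree.ofFinsupp t) := by
  rw [galtonWatson, poissonFamily_eq_sum (fun τ => mul_nonneg hlam measureReal_nonneg)
    ((hasSum_real_singleton _).summable.mul_left lam), map_sum_smul_dirac]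
  simp only [RTree.ofMult_coe]

theorem isProbabilityMeasure_galtonWatson (hlam : 0 ≤ lam) (d : ℕ) :
    IsProbabilityMeasure (galtonWatson lam d) := by
  induction d with
  | zero => exact Measure.dirac.isProbabilityMeasure
  | succ d ih =>
    constructor
    rw [galtonWatson_succ_eq_sum hlam, Measure.sum_apply _ MeasurableSet.univ]
    have hr : ∀ τ : RTree d, 0 ≤ lam * (galtonWatson lam d).real {τ} :=
      fun τ => mul_nonneg hlam measureReal_nonneg
    have := hasSum_poissonWeight hr ((hasSum_real_singleton _).summable.mul_left lam)
    simp only [Measure.smul_apply, measure_univ, smul_eq_mul, mul_one]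
    rw [← ENNReal.ofReal_tsum_of_nonneg (poissonWeight_nonneg hr) this.summable, this.tsum_eq,
      ENNReal.ofReal_one]

theorem galtonWatson_succ_real_singleton (hlam : 0 ≤ lam) (t : RTree (d + 1)) :
    (galtonWatson lam (d + 1)).real {t} =
      poissonWeight (fun τ => lam * (galtonWatson lam d).real {τ}) t.mult := by
  have := isProbabilityMeasure_galtonWatson hlam d
  rw [galtonWatson_succ_eq_sum hlam, real_sum_smul_dirac_singleton
    (poissonWeight_nonneg fun τ => mul_nonneg hlam measureReal_nonneg),
    tsum_eq_single t.mult]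
  · exact if_pos rfl
  · intro t' h
    exact if_neg h

end Laws

/-! ### Mass function of a pair of configurations sharing paired points -/

section PairCount

variable {X : Type}

theorem Finsupp.mapDomain_snd_ne_zero {Y Z : Type*} {M : Y × Z →₀ ℕ} {q : Y × Z} (hq : q ∈ M.support) :
    M.mapDomain Prod.snd q.2 ≠ 0 := by
  rw [← Finsupp.sub_add_single_of_mem_support hq, Finsupp.mapDomain_add, Finsupp.mapDomain_single]
  simp

theorem Finsupp.mapDomain_fst_ne_zero {Y Z : Type*} {M : Y × Z →₀ ℕ} {q : Y × Z} (hq : q ∈ M.support) :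
    M.mapDomain Prod.fst q.1 ≠ 0 := by
  rw [← Finsupp.sub_add_single_of_mem_support hq, Finsupp.mapDomain_add, Finsupp.mapDomain_single]
  simp

theorem Finsupp.mapDomain_fst_apply_eq_sum {Y Z : Type*} (M : Y × Z →₀ ℕ) (S : Finset Z)
    (hS : ∀ q ∈ M.support, q.2 ∈ S) (y : Y) :
    M.mapDomain Prod.fst y = ∑ z ∈ S, M (y, z) := by
  classical
  induction M using Finsupp.induction_add_single_one with
  | zero => simp
  | add M q ih =>
    rw [Finsupp.mapDomain_add, Finsupp.mapDomain_single, Finsupp.add_apply, ih]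
    · have hq : q.2 ∈ S := hS q (by simp)
      simp only [Finsupp.add_apply, Finset.sum_add_distrib]
      congr 1
      obtain ⟨y', z'⟩ := q
      rw [Finset.sum_eq_single_of_mem z' hq]
      · simp [Finsupp.single_apply]
      · intro z _ hz
        rw [Finsupp.single_apply, if_neg]
        intro h
        exact hz (Prod.ext_iff.mp h).2.symm
    · intro q' hq'
      refine hS q' ?_
      rw [Finsupp.mem_support_iff] at hq' ⊢
      simp only [Finsupp.add_apply]
      omega

theorem Finsupp.tsum_fst_eq_mapDomain {Y Z : Type*} (M : Y × Z →₀ ℕ) (y : Y) :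
    ∑' z, M (y, z) = M.mapDomain Prod.fst y := by
  classical
  rw [M.mapDomain_fst_apply_eq_sum (M.support.image Prod.snd)
    (fun q hq => Finset.mem_image_of_mem _ hq), tsum_eq_sum]
  intro z hz
  by_contra h
  exact hz (Finset.mem_image.mpr ⟨(y, z), Finsupp.mem_support_iff.mpr h, rfl⟩)

theorem Finsupp.tsum_snd_eq_mapDomain {Y Z : Type*} (M : Y × Z →₀ ℕ) (z : Z) :
    ∑' y, M (y, z) = M.mapDomain Prod.snd z := by
  have h := (M.mapDomain Prod.swap).tsum_fst_eq_mapDomain z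
  rw [← Finsupp.mapDomain_comp] at h
  refine Eq.trans (tsum_congr fun y => ?_) h
  exact (Finsupp.mapDomain_apply Prod.swap_injective M (y, z)).symm

/-- The multiplicities of the two marginal configurations. -/
noncomputable def pairCount (ω : (X →₀ ℕ) × (X →₀ ℕ) × (X × X →₀ ℕ)) : (X →₀ ℕ) × (X →₀ ℕ) :=
  (ω.1 + ω.2.2.mapDomain Prod.fst, ω.2.1 + ω.2.2.mapDomain Prod.snd)

variable (r r' : X → ℝ) (ρ : X × X → ℝ)

/-- The joint mass function of three Poisson families. -/
noncomputable def tripleWeight (ω : (X →₀ ℕ) × (X →₀ ℕ) × (X × X →₀ ℕ)) : ℝ :=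
  poissonWeight r ω.1 * (poissonWeight r' ω.2.1 * poissonWeight ρ ω.2.2)

open Classical in
/-- The mass function of the pair of configurations. -/
noncomputable def pairMass (t t' : X →₀ ℕ) : ℝ :=
  ∑' ω, if pairCount ω = (t, t') then tripleWeight r r' ρ ω else 0

theorem pairMass_zero_zero :
    pairMass r r' ρ 0 0 =
      Real.exp (-∑' i, r i) * (Real.exp (-∑' i, r' i) * Real.exp (-∑' i, ρ i)) := by
  rw [pairMass, tsum_eq_single 0]
  · rw [if_pos]
    · simp [tripleWeight, poissonWeight_zero]
    · simp [pairCount]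
  · rintro ⟨Δ, Δ', M⟩ hω
    rw [if_neg]
    intro h
    simp only [pairCount, Prod.mk.injEq, add_eq_zero] at h
    obtain ⟨⟨h1, h2⟩, h3, -⟩ := h
    have hM : M = 0 := by
      rw [← Finsupp.support_eq_empty, Finset.eq_empty_iff_forall_notMem]
      intro q hq
      exact Finsupp.mapDomain_fst_ne_zero hq (DFunLike.congr_fun h2 q.1)
    exact hω (by rw [h1, h3, hM]; rfl)

variable {r r' ρ}

theorem tripleWeight_nonneg (hr : ∀ i, 0 ≤ r i) (hr' : ∀ i, 0 ≤ r' i) (hρ : ∀ i, 0 ≤ ρ i)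
    (ω : (X →₀ ℕ) × (X →₀ ℕ) × (X × X →₀ ℕ)) : 0 ≤ tripleWeight r r' ρ ω :=
  mul_nonneg (poissonWeight_nonneg hr _)
    (mul_nonneg (poissonWeight_nonneg hr' _) (poissonWeight_nonneg hρ _))

open Classical in
-- The factor `ω.1 τ` kills the triples without an unpaired `τ`; the others arise uniquely by adding
-- such a point, and `(k+1) w(k+1) = r w(k)` turns the count into the rate. The two analogues below
-- shift the second and third components.
theorem tsum_left_mul_pairMass (t t' : X →₀ ℕ) (τ : X) :
    ∑' ω : (X →₀ ℕ) × (X →₀ ℕ) × (X × X →₀ ℕ), (ω.1 τ : ℝ) *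
      (if pairCount ω = (t + Finsupp.single τ 1, t') then tripleWeight r r' ρ ω else 0) =
      r τ * pairMass r r' ρ t t' := by
  have hinj : Function.Injective (fun ω : (X →₀ ℕ) × (X →₀ ℕ) × (X × X →₀ ℕ) =>
      (ω.1 + Finsupp.single τ 1, ω.2)) := by
    rintro ⟨Δ, ω⟩ ⟨Δ', ω'⟩ h
    simpa using h
  rw [pairMass, ← tsum_mul_left, ← hinj.tsum_eq]
  · refine tsum_congr fun ω => ?_
    have h1 : pairCount (ω.1 + Finsupp.single τ 1, ω.2) = (t + Finsupp.single τ 1, t') ↔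
        pairCount ω = (t, t') := by
      simp only [pairCount, Prod.mk.injEq]
      rw [add_right_comm, add_left_inj]
    simp only [h1]
    split_ifs
    · have := poissonWeight_add_single r ω.1 τ
      simp only [tripleWeight, Finsupp.add_apply, Finsupp.single_eq_same]
      push_cast
      linear_combination (poissonWeight r' ω.2.1 * poissonWeight ρ ω.2.2) * this
    · simp
  · rintro ⟨Δ, ω⟩ hω
    by_contra h
    refine hω ?_
    have h0 : τ ∈ Δ.support := by
      rw [Finsupp.mem_support_iff]
      rintro h'
      simp [h'] at hω
    exact absurd ⟨(Δ - Finsupp.single τ 1, ω),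
      Prod.ext (Finsupp.sub_add_single_of_mem_support h0) rfl⟩ h

open Classical in
theorem tsum_right_mul_pairMass (t t' : X →₀ ℕ) (τ' : X) :
    ∑' ω : (X →₀ ℕ) × (X →₀ ℕ) × (X × X →₀ ℕ), (ω.2.1 τ' : ℝ) *
      (if pairCount ω = (t, t' + Finsupp.single τ' 1) then tripleWeight r r' ρ ω else 0) =
      r' τ' * pairMass r r' ρ t t' := by
  have hinj : Function.Injective (fun ω : (X →₀ ℕ) × (X →₀ ℕ) × (X × X →₀ ℕ) =>
      (ω.1, ω.2.1 + Finsupp.single τ' 1, ω.2.2)) := by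
    rintro ⟨Δ, Δ', ω⟩ ⟨_, _, ω'⟩ h
    simpa using h
  rw [pairMass, ← tsum_mul_left, ← hinj.tsum_eq]
  · refine tsum_congr fun ω => ?_
    have h1 : pairCount (ω.1, ω.2.1 + Finsupp.single τ' 1, ω.2.2) =
        (t, t' + Finsupp.single τ' 1) ↔ pairCount ω = (t, t') := by
      simp only [pairCount, Prod.mk.injEq]
      rw [add_right_comm, add_left_inj]
    simp only [h1]
    split_ifs
    · have := poissonWeight_add_single r' ω.2.1 τ'
      simp only [tripleWeight, Finsupp.add_apply, Finsupp.single_eq_same]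
      push_cast
      linear_combination (poissonWeight r ω.1 * poissonWeight ρ ω.2.2) * this
    · simp
  · rintro ⟨Δ, Δ', ω⟩ hω
    by_contra h
    have h0 : τ' ∈ Δ'.support := by
      rw [Finsupp.mem_support_iff]
      rintro h'
      simp [h'] at hω
    exact h ⟨(Δ, Δ' - Finsupp.single τ' 1, ω),
      Prod.ext rfl (Prod.ext (Finsupp.sub_add_single_of_mem_support h0) rfl)⟩

open Classical in
theorem tsum_both_mul_pairMass (t t' : X →₀ ℕ) (τ τ' : X) :
    ∑' ω : (X →₀ ℕ) × (X →₀ ℕ) × (X × X →₀ ℕ), (ω.2.2 (τ, τ') : ℝ) *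
      (if pairCount ω = (t + Finsupp.single τ 1, t' + Finsupp.single τ' 1) then
        tripleWeight r r' ρ ω else 0) =
      ρ (τ, τ') * pairMass r r' ρ t t' := by
  have hinj : Function.Injective (fun ω : (X →₀ ℕ) × (X →₀ ℕ) × (X × X →₀ ℕ) =>
      (ω.1, ω.2.1, ω.2.2 + Finsupp.single (τ, τ') 1)) := by
    rintro ⟨Δ, Δ', ω⟩ ⟨_, _, ω'⟩ h
    simpa using h
  rw [pairMass, ← tsum_mul_left, ← hinj.tsum_eq]
  · refine tsum_congr fun ω => ?_
    have h1 : pairCount (ω.1, ω.2.1, ω.2.2 + Finsupp.single (τ, τ') 1) =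
        (t + Finsupp.single τ 1, t' + Finsupp.single τ' 1) ↔ pairCount ω = (t, t') := by
      simp [pairCount, ← add_assoc, Finsupp.mapDomain_add, Finsupp.mapDomain_single]
    simp only [h1]
    split_ifs
    · have := poissonWeight_add_single ρ ω.2.2 (τ, τ')
      simp only [tripleWeight, Finsupp.add_apply, Finsupp.single_eq_same]
      push_cast
      linear_combination (poissonWeight r ω.1 * poissonWeight r' ω.2.1) * this
    · simp
  · rintro ⟨Δ, Δ', ω⟩ hω
    by_contra h
    have h0 : (τ, τ') ∈ ω.support := by
      rw [Finsupp.mem_support_iff]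
      rintro h'
      simp [h'] at hω
    exact h ⟨(Δ, Δ', ω - Finsupp.single (τ, τ') 1),
      Prod.ext rfl (Prod.ext rfl (Finsupp.sub_add_single_of_mem_support h0))⟩

/-- An empty first configuration forces `M = 0`, so every point of the second one is unpaired. -/
theorem pairMass_zero_add_single (t' : X →₀ ℕ) (τ' : X) :
    pairMass r r' ρ 0 (t' + Finsupp.single τ' 1) * (t' τ' + 1) =
      r' τ' * pairMass r r' ρ 0 t' := by
  classical
  rw [← tsum_right_mul_pairMass, pairMass, ← tsum_mul_right]
  refine tsum_congr fun ω => ?_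
  obtain ⟨Δ, Δ', M⟩ := ω
  split_ifs with h
  · simp only [pairCount, Prod.mk.injEq, add_eq_zero] at h
    obtain ⟨⟨-, h2⟩, h3⟩ := h
    have hM : M = 0 := by
      rw [← Finsupp.support_eq_empty, Finset.eq_empty_iff_forall_notMem]
      intro q hq
      exact Finsupp.mapDomain_fst_ne_zero hq (DFunLike.congr_fun h2 q.1)
    rw [hM, Finsupp.mapDomain_zero, add_zero] at h3
    rw [h3, Finsupp.add_apply, Finsupp.single_eq_same]
    push_cast
    ring
  · simp

variable [Countable X]

open Classical in
-- Each of the `t τ + 1` points `τ` is either unpaired or paired with some `τ'` of the second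
-- configuration. Splitting the count accordingly and removing the counted point gives the right
-- side.
theorem pairMass_add_single (hr : ∀ i, 0 ≤ r i) (hrs : Summable r) (hr' : ∀ i, 0 ≤ r' i)
    (hrs' : Summable r') (hρ : ∀ i, 0 ≤ ρ i) (hρs : Summable ρ) (t : X →₀ ℕ) (τ : X)
    (t' : X →₀ ℕ) :
    pairMass r r' ρ (t + Finsupp.single τ 1) t' * (t τ + 1) = r τ * pairMass r r' ρ t t' +
      ∑ τ' ∈ t'.support, ρ (τ, τ') * pairMass r r' ρ t (t' - Finsupp.single τ' 1) := by
  set I : (X →₀ ℕ) × (X →₀ ℕ) × (X × X →₀ ℕ) → ℝ := fun ω =>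
    if pairCount ω = (t + Finsupp.single τ 1, t') then tripleWeight r r' ρ ω else 0 with hI
  have hI0 : ∀ ω, 0 ≤ I ω := by
    intro ω
    simp only [hI]
    split_ifs
    · exact tripleWeight_nonneg hr hr' hρ ω
    · exact le_rfl
  have hIs : Summable I := by
    refine Summable.of_nonneg_of_le hI0 (fun ω => ?_) ((hasSum_poissonWeight hr hrs).mul_real
      ((hasSum_poissonWeight hr' hrs').mul_real (hasSum_poissonWeight hρ hρs))).summable
    simp only [hI]
    split_ifs
    · exact le_rfl
    · exact tripleWeight_nonneg hr hr' hρ ω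
  have hident : ∀ ω, I ω * (t τ + 1) = ω.1 τ * I ω + ∑ τ' ∈ t'.support, ω.2.2 (τ, τ') * I ω := by
    rintro ⟨Δ, Δ', M⟩
    by_cases h : pairCount (Δ, Δ', M) = (t + Finsupp.single τ 1, t')
    · simp only [pairCount, Prod.mk.injEq] at h
      obtain ⟨h1, h2⟩ := h
      have h3 := DFunLike.congr_fun h1 τ
      -- On this event the partners present in `M` all lie in `t'.support`, so the count of paired
      -- points is a finite sum over a set independent of `M`.
      rw [Finsupp.add_apply, M.mapDomain_fst_apply_eq_sum t'.support, Finsupp.add_apply,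
        Finsupp.single_eq_same] at h3
      · have h4 : ((Δ τ : ℝ) + ∑ τ' ∈ t'.support, (M (τ, τ') : ℝ)) = t τ + 1 := by
          exact_mod_cast h3
        rw [← h4, ← Finset.sum_mul]
        ring
      · intro q hq
        rw [← h2, Finsupp.mem_support_iff, Finsupp.add_apply]
        have := Finsupp.mapDomain_snd_ne_zero hq
        omega
    · have : I (Δ, Δ', M) = 0 := if_neg h
      simp [this]
  have hIm : Summable fun ω => I ω * (t τ + 1) := hIs.mul_right _
  have hM0 : ∀ (ω : (X →₀ ℕ) × (X →₀ ℕ) × (X × X →₀ ℕ)) (τ' : X),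
      (0 : ℝ) ≤ ω.2.2 (τ, τ') * I ω := fun ω τ' =>
    mul_nonneg (Nat.cast_nonneg _) (hI0 ω)
  have h1s : Summable fun ω : (X →₀ ℕ) × (X →₀ ℕ) × (X × X →₀ ℕ) => (ω.1 τ : ℝ) * I ω := by
    refine Summable.of_nonneg_of_le (fun ω => mul_nonneg (Nat.cast_nonneg _) (hI0 ω))
      (fun ω => ?_) hIm
    rw [hident]
    exact le_add_of_nonneg_right (Finset.sum_nonneg fun τ' _ => hM0 ω τ')
  have h2s : ∀ τ' ∈ t'.support, Summable fun ω : (X →₀ ℕ) × (X →₀ ℕ) × (X × X →₀ ℕ) =>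
      (ω.2.2 (τ, τ') : ℝ) * I ω := by
    intro τ' hτ'
    refine Summable.of_nonneg_of_le (fun ω => hM0 ω τ') (fun ω => ?_) hIm
    rw [hident]
    refine (Finset.single_le_sum (f := fun τ' => (ω.2.2 (τ, τ') : ℝ) * I ω)
      (fun τ' _ => hM0 ω τ') hτ').trans ?_
    exact le_add_of_nonneg_left (mul_nonneg (Nat.cast_nonneg _) (hI0 ω))
  rw [pairMass, ← tsum_mul_right, tsum_congr hident, h1s.tsum_add (summable_sum h2s),
    tsum_left_mul_pairMass, Summable.tsum_finsetSum h2s]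
  congr 1
  refine Finset.sum_congr rfl fun τ' hτ' => ?_
  rw [← tsum_both_mul_pairMass, Finsupp.sub_add_single_of_mem_support hτ']

end PairCount

/-! ### Recursion of the likelihood ratio under adding a child of the root -/

section CorrelatedModel

variable {lam s : ℝ} {d : ℕ}

theorem correlatedPair_coe (ω : (RTree d →₀ ℕ) × (RTree d →₀ ℕ) × (RTree d × RTree d →₀ ℕ)) :
    correlatedPair (⇑ω.1, ⇑ω.2.1, ⇑ω.2.2) =
      (RTree.ofFinsupp (pairCount ω).1, RTree.ofFinsupp (pairCount ω).2) := by
  rw [correlatedPair, ← RTree.ofMult_coe, ← RTree.ofMult_coe]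
  simp only [Finsupp.tsum_fst_eq_mapDomain, Finsupp.tsum_snd_eq_mapDomain]
  rfl

variable (lam s d) in
/-- The rate of the unpaired subtrees. -/
noncomputable def soloRate (τ : RTree d) : ℝ := lam * (1 - s) * (galtonWatson lam d).real {τ}

variable (lam s d) in
/-- The rate of the paired subtrees. -/
noncomputable def pairRate (q : RTree d × RTree d) : ℝ :=
  lam * s * (correlatedModel lam s d).real {q}

theorem soloRate_nonneg (hlam : 0 ≤ lam) (hs : s ∈ Set.Icc (0 : ℝ) 1) (τ : RTree d) :
    0 ≤ soloRate lam s d τ :=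
  mul_nonneg (mul_nonneg hlam (sub_nonneg.mpr hs.2)) measureReal_nonneg

theorem pairRate_nonneg (hlam : 0 ≤ lam) (hs : s ∈ Set.Icc (0 : ℝ) 1) (q : RTree d × RTree d) :
    0 ≤ pairRate lam s d q :=
  mul_nonneg (mul_nonneg hlam hs.1) measureReal_nonneg

theorem hasSum_soloRate (hlam : 0 ≤ lam) : HasSum (soloRate lam s d) (lam * (1 - s)) := by
  have := isProbabilityMeasure_galtonWatson hlam d
  have h := (hasSum_real_singleton (galtonWatson lam d)).mul_left (lam * (1 - s))
  rwa [mul_one] at h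

theorem hasSum_pairRate [IsProbabilityMeasure (correlatedModel lam s d)] :
    HasSum (pairRate lam s d) (lam * s) := by
  have h := (hasSum_real_singleton (correlatedModel lam s d)).mul_left (lam * s)
  rwa [mul_one] at h

theorem correlatedModel_succ_eq_sum (hlam : 0 ≤ lam) (hs : s ∈ Set.Icc (0 : ℝ) 1)
    [IsProbabilityMeasure (correlatedModel lam s d)] :
    correlatedModel lam s (d + 1) = Measure.sum fun
      ω : (RTree d →₀ ℕ) × (RTree d →₀ ℕ) × (RTree d × RTree d →₀ ℕ) =>
        ENNReal.ofReal (tripleWeight (soloRate lam s d) (soloRate lam s d) (pairRate lam s d) ω) •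
        Measure.dirac (RTree.ofFinsupp (pairCount ω).1, RTree.ofFinsupp (pairCount ω).2) := by
  have h1 := soloRate_nonneg (d := d) hlam hs
  have h2 := pairRate_nonneg (d := d) hlam hs
  change (((poissonFamily (soloRate lam s d)).prod ((poissonFamily (soloRate lam s d)).prod
    (poissonFamily (pairRate lam s d)))).map correlatedPair) = _
  rw [poissonFamily_eq_sum h1 (hasSum_soloRate hlam).summable,
    poissonFamily_eq_sum h2 hasSum_pairRate.summable,
    prod_sum_smul_dirac (poissonWeight_nonneg h1), prod_sum_smul_dirac (poissonWeight_nonneg h1),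
    map_sum_smul_dirac]
  simp only [correlatedPair_coe]
  rfl

theorem isProbabilityMeasure_correlatedModel (hlam : 0 ≤ lam) (hs : s ∈ Set.Icc (0 : ℝ) 1)
    (d : ℕ) : IsProbabilityMeasure (correlatedModel lam s d) := by
  induction d with
  | zero =>
    have := isProbabilityMeasure_galtonWatson hlam 0
    exact inferInstanceAs (IsProbabilityMeasure ((galtonWatson lam 0).prod (galtonWatson lam 0)))
  | succ d ih =>
    constructor
    rw [correlatedModel_succ_eq_sum hlam hs, Measure.sum_apply _ MeasurableSet.univ]
    have h1 := soloRate_nonneg (d := d) hlam hs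
    have h2 := pairRate_nonneg (d := d) hlam hs
    have h3 := hasSum_poissonWeight h1 (hasSum_soloRate hlam).summable
    have h4 : HasSum (tripleWeight (soloRate lam s d) (soloRate lam s d) (pairRate lam s d))
        (1 * (1 * 1)) :=
      h3.mul_real (h3.mul_real (hasSum_poissonWeight h2 hasSum_pairRate.summable))
    simp only [Measure.smul_apply, measure_univ, smul_eq_mul, mul_one]
    rw [← ENNReal.ofReal_tsum_of_nonneg (tripleWeight_nonneg h1 h1 h2) h4.summable, h4.tsum_eq]
    simp

theorem correlatedModel_succ_real_singleton (hlam : 0 ≤ lam) (hs : s ∈ Set.Icc (0 : ℝ) 1)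
    (t t' : RTree (d + 1)) :
    (correlatedModel lam s (d + 1)).real {(t, t')} =
      pairMass (soloRate lam s d) (soloRate lam s d) (pairRate lam s d) t.mult t'.mult := by
  classical
  have := isProbabilityMeasure_correlatedModel hlam hs d
  rw [correlatedModel_succ_eq_sum hlam hs, real_sum_smul_dirac_singleton (tripleWeight_nonneg
    (soloRate_nonneg hlam hs) (soloRate_nonneg hlam hs) (pairRate_nonneg hlam hs)), pairMass]
  refine tsum_congr fun ω => ?_
  by_cases h : pairCount ω = (t.mult, t'.mult)
  · rw [if_pos h, if_pos]
    rw [h]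
    rfl
  · rw [if_neg h, if_neg]
    intro h'
    exact h h'

theorem nullModel_real_singleton (hlam : 0 ≤ lam) (t t' : RTree d) :
    (nullModel lam d).real {(t, t')} =
      (galtonWatson lam d).real {t} * (galtonWatson lam d).real {t'} := by
  have := isProbabilityMeasure_galtonWatson hlam d
  rw [nullModel, ← Set.singleton_prod_singleton, measureReal_prod_prod]

theorem galtonWatson_real_singleton_pos (hlam : 0 < lam) (d : ℕ) (t : RTree d) :
    0 < (galtonWatson lam d).real {t} := by
  induction d with
  | zero =>
    have : t = RTree.trivialTree 0 := rfl
    rw [this, galtonWatson]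
    simp [measureReal_def]
  | succ d ih =>
    rw [galtonWatson_succ_real_singleton hlam.le]
    exact poissonWeight_pos (fun τ => mul_pos hlam (ih τ)) _

theorem likelihoodRatio_eq_div (hlam : 0 ≤ lam) (t t' : RTree d) :
    likelihoodRatio lam s d t t' = (correlatedModel lam s d).real {(t, t')} /
      ((galtonWatson lam d).real {t} * (galtonWatson lam d).real {t'}) := by
  rw [likelihoodRatio, nullModel_real_singleton hlam]

theorem likelihoodRatio_trivial_trivial (hlam : 0 ≤ lam) (hs : s ∈ Set.Icc (0 : ℝ) 1) :
    likelihoodRatio lam s (d + 1) (RTree.ofFinsupp 0) (RTree.ofFinsupp 0) =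
      Real.exp (lam * s) := by
  have := isProbabilityMeasure_correlatedModel hlam hs d
  have := isProbabilityMeasure_galtonWatson hlam d
  have h1 : HasSum (fun τ => lam * (galtonWatson lam d).real {τ}) lam := by
    simpa using (hasSum_real_singleton (galtonWatson lam d)).mul_left lam
  rw [likelihoodRatio_eq_div hlam, correlatedModel_succ_real_singleton hlam hs,
    galtonWatson_succ_real_singleton hlam]
  change pairMass _ _ _ 0 0 / (poissonWeight _ 0 * poissonWeight _ 0) = _
  rw [pairMass_zero_zero, poissonWeight_zero, (hasSum_soloRate hlam).tsum_eq,
    hasSum_pairRate.tsum_eq, h1.tsum_eq, ← Real.exp_add, ← Real.exp_add, ← Real.exp_add,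
    ← Real.exp_sub]
  congr 1
  ring

theorem likelihoodRatio_trivial_add_single (hlam : 0 < lam) (hs : s ∈ Set.Icc (0 : ℝ) 1)
    (t' : RTree d →₀ ℕ) (τ' : RTree d) :
    likelihoodRatio lam s (d + 1) (RTree.ofFinsupp 0)
      (RTree.ofFinsupp (t' + Finsupp.single τ' 1)) =
      (1 - s) * likelihoodRatio lam s (d + 1) (RTree.ofFinsupp 0) (RTree.ofFinsupp t') := by
  simp only [likelihoodRatio_eq_div hlam.le, correlatedModel_succ_real_singleton hlam.le hs,
    galtonWatson_succ_real_singleton hlam.le]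
  change pairMass _ _ _ 0 (t' + Finsupp.single τ' 1) /
    (poissonWeight _ 0 * poissonWeight _ (t' + Finsupp.single τ' 1)) =
    (1 - s) * (pairMass _ _ _ 0 t' / (poissonWeight _ 0 * poissonWeight _ t'))
  set w : RTree d → ℝ := fun τ => lam * (galtonWatson lam d).real {τ} with hw
  have hwpos : ∀ τ, 0 < w τ := fun τ => mul_pos hlam (galtonWatson_real_singleton_pos hlam d τ)
  have h1 := pairMass_zero_add_single (r := soloRate lam s d) (r' := soloRate lam s d)
    (ρ := pairRate lam s d) t' τ'
  have h2 := poissonWeight_add_single w t' τ'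
  have h3 : soloRate lam s d τ' = (1 - s) * w τ' := by
    simp only [soloRate, hw]
    ring
  have h4 := (poissonWeight_pos hwpos t').ne'
  have h5 := (poissonWeight_pos hwpos (t' + Finsupp.single τ' 1)).ne'
  have h6 := (poissonWeight_pos hwpos 0).ne'
  have h7 : (t' τ' : ℝ) + 1 ≠ 0 := by positivity
  rw [h3] at h1
  rw [mul_div_assoc', div_eq_div_iff (mul_ne_zero h6 h5) (mul_ne_zero h6 h4)]
  refine mul_right_cancel₀ h7 ?_
  linear_combination (poissonWeight w 0 * poissonWeight w t') * h1 -
    (1 - s) * pairMass (soloRate lam s d) (soloRate lam s d) (pairRate lam s d) 0 t' *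
      poissonWeight w 0 * h2

/-- Dividing `pairMass_add_single` by the Galton-Watson masses: the unpaired rate is the fraction `1
- s` of the full rate, and the paired rate over the product of the masses one level below is `lam *
s` times the likelihood ratio of the subtrees. -/
theorem likelihoodRatio_add_single (hlam : 0 < lam) (hs : s ∈ Set.Icc (0 : ℝ) 1)
    (t : RTree d →₀ ℕ) (τ : RTree d) (t' : RTree d →₀ ℕ) :
    likelihoodRatio lam s (d + 1) (RTree.ofFinsupp (t + Finsupp.single τ 1))
      (RTree.ofFinsupp t') =
      (1 - s) * likelihoodRatio lam s (d + 1) (RTree.ofFinsupp t) (RTree.ofFinsupp t') +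
      s / lam * ∑ τ' ∈ t'.support, t' τ' * likelihoodRatio lam s d τ τ' *
        likelihoodRatio lam s (d + 1) (RTree.ofFinsupp t)
          (RTree.ofFinsupp (t' - Finsupp.single τ' 1)) := by
  have := isProbabilityMeasure_correlatedModel hlam.le hs d
  simp only [likelihoodRatio_eq_div (d := d + 1) hlam.le,
    correlatedModel_succ_real_singleton hlam.le hs, galtonWatson_succ_real_singleton hlam.le]
  set w : RTree d → ℝ := fun τ => lam * (galtonWatson lam d).real {τ} with hw
  set c := pairMass (soloRate lam s d) (soloRate lam s d) (pairRate lam s d) with hc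
  change c (t + Finsupp.single τ 1) t' /
    (poissonWeight w (t + Finsupp.single τ 1) * poissonWeight w t') =
    (1 - s) * (c t t' / (poissonWeight w t * poissonWeight w t')) +
    s / lam * ∑ τ' ∈ t'.support, t' τ' * likelihoodRatio lam s d τ τ' *
      (c t (t' - Finsupp.single τ' 1) /
        (poissonWeight w t * poissonWeight w (t' - Finsupp.single τ' 1)))
  have hwpos : ∀ τ, 0 < w τ := fun τ => mul_pos hlam (galtonWatson_real_singleton_pos hlam d τ)
  have hW : ∀ t, poissonWeight w t ≠ 0 := fun t => (poissonWeight_pos hwpos t).ne'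
  have h1 : c (t + Finsupp.single τ 1) t' * (t τ + 1) = soloRate lam s d τ * c t t' +
      ∑ τ' ∈ t'.support, pairRate lam s d (τ, τ') * c t (t' - Finsupp.single τ' 1) :=
    pairMass_add_single (soloRate_nonneg hlam.le hs)
    (hasSum_soloRate hlam.le).summable (soloRate_nonneg hlam.le hs)
    (hasSum_soloRate hlam.le).summable (pairRate_nonneg hlam.le hs)
    hasSum_pairRate.summable t τ t'
  have h2 := poissonWeight_add_single w t τ
  have h3 : soloRate lam s d τ = (1 - s) * w τ := by
    simp only [soloRate, hw]
    ring
  have h7 : (t τ : ℝ) + 1 ≠ 0 := by positivity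
  have hτ' : ∀ τ' ∈ t'.support, t' τ' * likelihoodRatio lam s d τ τ' *
      (c t (t' - Finsupp.single τ' 1) /
        (poissonWeight w t * poissonWeight w (t' - Finsupp.single τ' 1))) * (s / lam) =
      pairRate lam s d (τ, τ') * c t (t' - Finsupp.single τ' 1) /
        (w τ * poissonWeight w t * poissonWeight w t') := by
    intro τ' hτ'
    have h8 := poissonWeight_add_single w (t' - Finsupp.single τ' 1) τ'
    have h9 : (((t' - Finsupp.single τ' 1 : RTree d →₀ ℕ) τ' : ℕ) : ℝ) + 1 = t' τ' := by
      conv_rhs => rw [← Finsupp.sub_add_single_of_mem_support hτ', Finsupp.add_apply,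
        Finsupp.single_eq_same]
      push_cast
      rfl
    rw [Finsupp.sub_add_single_of_mem_support hτ', h9] at h8
    have h10 := (galtonWatson_real_singleton_pos hlam d τ).ne'
    have h11 := (galtonWatson_real_singleton_pos hlam d τ').ne'
    have h12 := hlam.ne'
    have h13 := hW t'
    have h14 := hW (t' - Finsupp.single τ' 1)
    have h15 := hW t
    rw [likelihoodRatio_eq_div hlam.le]
    simp only [pairRate, hw] at h8 h13 h14 h15 ⊢
    have h16 : (t' τ' : ℝ) = lam * (galtonWatson lam d).real {τ'} *
        poissonWeight (fun τ => lam * (galtonWatson lam d).real {τ}) (t' - Finsupp.single τ' 1) /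
        poissonWeight (fun τ => lam * (galtonWatson lam d).real {τ}) t' := by
      rw [eq_div_iff h13, ← h8]
      ring
    rw [h16]
    field_simp
  rw [mul_comm (s / lam), Finset.sum_mul, Finset.sum_congr rfl hτ', ← Finset.sum_div]
  have h5 : poissonWeight w (t + Finsupp.single τ 1) = w τ * poissonWeight w t / (t τ + 1) := by
    rw [eq_div_iff h7, h2]
  have h6 := hW t
  have h8 := hW t'
  have h9 := (hwpos τ).ne'
  rw [← eq_div_iff h7] at h1
  rw [h1, h3, h5]
  field_simp

end CorrelatedModel

/-! ### The orthonormal functions on trees and their properties -/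

section TreeChaos

/-- The orthonormal functions on trees: Poisson chaos functions of the functions one level below. -/
noncomputable def treeChaos (lam : ℝ) : (d : ℕ) → RTree d → RTree d → ℝ
  | 0 => fun _ _ => 1
  | d + 1 => fun β t => poissonChaos lam (treeChaos lam d) (RTree.trivialTree d) β.mult t.mult

variable {lam s : ℝ}

theorem RTree.one_le_size {d : ℕ} (t : RTree d) : 1 ≤ t.size := by
  cases d with
  | zero => rw [RTree.size]
  | succ d =>
    rw [RTree.size]
    exact Nat.le_add_right _ _

theorem RTree.size_trivialTree (d : ℕ) : (RTree.trivialTree d).size = 1 := by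
  cases d with
  | zero => rw [RTree.size]
  | succ d =>
    rw [RTree.size]
    change 1 + (0 : RTree d →₀ ℕ).sum _ = 1
    simp

/-- The root being discounted, the weight is multiplicative over the subtrees with `q γ = s ^ |γ|`,
as the kernel expansion requires; the trivial subtree has `q o = s`. -/
theorem RTree.pow_size_sub_one {d : ℕ} (s : ℝ) (β : RTree (d + 1)) :
    s ^ (β.size - 1) = β.mult.prod fun γ n => (s ^ γ.size) ^ n := by
  rw [RTree.size, Nat.add_sub_cancel_left, Finsupp.sum, ← Finset.prod_pow_eq_pow_sum]
  refine Finset.prod_congr rfl fun γ _ => ?_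
  dsimp only
  rw [← pow_mul, mul_comm]

theorem RTree.hasSum_zero (f : RTree 0 → ℝ) : HasSum f (f (RTree.trivialTree 0)) :=
  hasSum_single _ fun _ h => absurd rfl h

theorem galtonWatson_zero_real_singleton (t : RTree 0) : (galtonWatson lam 0).real {t} = 1 := by
  have : t = RTree.trivialTree 0 := rfl
  rw [this, galtonWatson]
  simp [measureReal_def]

theorem treeChaos_trivialTree (d : ℕ) (t : RTree d) :
    treeChaos lam d (RTree.trivialTree d) t = 1 := by
  cases d with
  | zero => rfl
  | succ d => exact poissonChaos_zero_left _ _ _ t.mult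

theorem galtonWatson_add_single (hlam : 0 ≤ lam) {d : ℕ} (t : RTree d →₀ ℕ) (τ : RTree d) :
    (galtonWatson lam (d + 1)).real {RTree.ofFinsupp (t + Finsupp.single τ 1)} * (t τ + 1) =
      lam * (galtonWatson lam d).real {τ} *
        (galtonWatson lam (d + 1)).real {RTree.ofFinsupp t} := by
  rw [galtonWatson_succ_real_singleton hlam, galtonWatson_succ_real_singleton hlam]
  exact poissonWeight_add_single _ t τ

theorem hasSum_galtonWatson (hlam : 0 ≤ lam) (d : ℕ) :
    HasSum (fun t : RTree d => (galtonWatson lam d).real {t}) 1 := by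
  have := isProbabilityMeasure_galtonWatson hlam d
  exact hasSum_real_singleton _

theorem hasSum_treeChaos_orthonormal (hlam : 0 < lam) (d : ℕ) (β β' : RTree d) :
    HasSum (fun t : RTree d => (galtonWatson lam d).real {t} * treeChaos lam d β t *
      treeChaos lam d β' t) (if β = β' then 1 else 0) := by
  induction d with
  | zero =>
    rw [if_pos (show β = β' from rfl)]
    convert! RTree.hasSum_zero _
    simp [galtonWatson_zero_real_singleton, treeChaos]
  | succ d ih =>
    have h := hasSum_poissonChaos_mul_poissonChaos hlam
      (W := fun t => (galtonWatson lam (d + 1)).real {RTree.ofFinsupp t})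
      (galtonWatson_add_single hlam.le) (hasSum_galtonWatson hlam.le (d + 1))
      (treeChaos_trivialTree d) (fun γ γ' => by convert! ih γ γ') β.mult β'.mult
    convert! h using 1
    · ext t
      rw [mul_assoc]
      rfl
    · exact if_congr Iff.rfl rfl rfl

theorem hasSum_treeChaos_likelihoodRatio (hlam : 0 < lam) (hs : s ∈ Set.Icc (0 : ℝ) 1) (d : ℕ)
    (t t' : RTree d) :
    HasSum (fun β : RTree d => s ^ (β.size - 1) * treeChaos lam d β t * treeChaos lam d β t')
      (likelihoodRatio lam s d t t') := by
  induction d with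
  | zero =>
    convert! RTree.hasSum_zero _
    rw [likelihoodRatio, correlatedModel, nullModel_real_singleton hlam.le,
      galtonWatson_zero_real_singleton, galtonWatson_zero_real_singleton, RTree.size]
    simp [treeChaos]
  | succ d ih =>
    have h := hasSum_poissonChaos_mul (φ := treeChaos lam d) (o := RTree.trivialTree d)
      (q := fun γ => s ^ γ.size) (ℓ := likelihoodRatio lam s d)
      (L := fun t t' => likelihoodRatio lam s (d + 1) (RTree.ofFinsupp t) (RTree.ofFinsupp t'))
      hlam (by rw [RTree.size_trivialTree, pow_one]) (treeChaos_trivialTree d) (fun τ τ' => by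
        convert! (ih τ τ').mul_left s using 1
        ext γ
        rw [← mul_assoc, ← mul_assoc, ← pow_succ', Nat.sub_add_cancel γ.one_le_size])
      (likelihoodRatio_trivial_trivial hlam.le hs) (likelihoodRatio_trivial_add_single hlam hs)
      (likelihoodRatio_add_single hlam hs) t.mult t'.mult
    convert! h using 1
    ext β
    rw [RTree.pow_size_sub_one]
    rfl

theorem hasSum_treeChaos_complete (hlam : 0 < lam) (d : ℕ) (t t' : RTree d) :
    HasSum (fun β : RTree d => treeChaos lam d β t * treeChaos lam d β t')
      ((if t = t' then 1 else 0) / (galtonWatson lam d).real {t}) := by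
  induction d with
  | zero =>
    rw [if_pos (show t = t' from rfl), galtonWatson_zero_real_singleton, div_one]
    convert! RTree.hasSum_zero _
    simp [treeChaos]
  | succ d ih =>
    have hpos : ∀ t : RTree d →₀ ℕ, (galtonWatson lam (d + 1)).real {RTree.ofFinsupp t} ≠ 0 :=
      fun t => (galtonWatson_real_singleton_pos hlam _ _).ne'
    -- At `s = 1` the unpaired terms disappear. The diagonal kernel divided by the mass satisfies
    -- the same recursion, since adding `τ` to `t` must be matched by removing `τ` from `t'`.
    have h := hasSum_poissonChaos_mul (φ := treeChaos lam d) (o := RTree.trivialTree d) (s := 1)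
      (q := fun γ => 1)
      (ℓ := fun τ τ' => (if τ = τ' then 1 else 0) / (galtonWatson lam d).real {τ})
      (L := fun t t' : RTree d →₀ ℕ => (if RTree.ofFinsupp t = RTree.ofFinsupp t' then 1 else 0) /
        (galtonWatson lam (d + 1)).real {RTree.ofFinsupp t})
      hlam rfl (treeChaos_trivialTree d) (fun τ τ' => by simpa using ih τ τ')
      (by
        have := isProbabilityMeasure_galtonWatson hlam.le d
        have h1 : HasSum (fun τ => lam * (galtonWatson lam d).real {τ}) lam := by
          simpa using (hasSum_galtonWatson hlam.le d).mul_left lam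
        rw [if_pos rfl, galtonWatson_succ_real_singleton hlam.le]
        change 1 / poissonWeight _ 0 = _
        rw [poissonWeight_zero, h1.tsum_eq, one_div, ← Real.exp_neg, neg_neg, mul_one])
      (by
        intro t' τ'
        rw [if_neg]
        · simp
        · intro h
          have h1 : (0 : RTree d →₀ ℕ) = t' + Finsupp.single τ' 1 := h
          simpa using DFunLike.congr_fun h1 τ')
      (by
        intro t τ t'
        have hinj : ∀ t t' : RTree d →₀ ℕ, RTree.ofFinsupp t = RTree.ofFinsupp t' ↔ t = t' :=
          fun _ _ => Iff.rfl
        have hrec := galtonWatson_add_single hlam.le t τ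
        have h7 : (t τ : ℝ) + 1 ≠ 0 := by positivity
        have h8 := (galtonWatson_real_singleton_pos hlam d τ).ne'
        have h9 := hpos t
        have h10 := hpos (t + Finsupp.single τ 1)
        have hterm : ∀ τ' ∈ t'.support, (t' τ' : ℝ) *
            ((if τ = τ' then 1 else 0) / (galtonWatson lam d).real {τ}) *
            ((if RTree.ofFinsupp t = RTree.ofFinsupp (t' - Finsupp.single τ' 1) then 1 else 0) /
              (galtonWatson lam (d + 1)).real {RTree.ofFinsupp t}) =
            if τ = τ' then (if t + Finsupp.single τ 1 = t' then (t τ + 1) /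
              ((galtonWatson lam d).real {τ} *
                (galtonWatson lam (d + 1)).real {RTree.ofFinsupp t}) else 0) else 0 := by
          intro τ' hτ'
          by_cases h : τ = τ'
          · subst h
            have h3 : RTree.ofFinsupp t = RTree.ofFinsupp (t' - Finsupp.single τ 1) ↔
                t + Finsupp.single τ 1 = t' := by
              rw [hinj]
              constructor
              · rintro rfl
                exact Finsupp.sub_add_single_of_mem_support hτ'
              · rintro rfl
                rw [add_tsub_cancel_right]
            rw [if_pos rfl, if_pos rfl]
            by_cases h4 : t + Finsupp.single τ 1 = t'
            · rw [if_pos (h3.mpr h4), if_pos h4, ← h4, Finsupp.add_apply, Finsupp.single_eq_same]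
              push_cast
              field_simp
            · rw [if_neg (fun h' => h4 (h3.mp h')), if_neg h4]
              simp
          · simp [h]
        rw [Finset.sum_congr rfl hterm, Finset.sum_ite_eq, sub_self, zero_mul, zero_add]
        by_cases h4 : t + Finsupp.single τ 1 = t'
        · have h5 : τ ∈ t'.support := by
            rw [← h4]
            simp
          rw [if_pos ((hinj _ _).mpr h4), if_pos h5, if_pos h4]
          have h6 := hlam.ne'
          field_simp
          linear_combination -hrec
        · rw [if_neg (fun h' => h4 ((hinj _ _).mp h')), if_neg h4]
          simp)
      t.mult t'.mult
    convert! h using 1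
    ext β
    have h1 : (Finsupp.prod (M := ℕ) β fun _ n => (1 : ℝ) ^ n) = 1 := by simp [Finsupp.prod]
    rw [h1, one_mul]
    rfl

theorem summable_prod_treeChaos (hlam : 0 < lam) (d : ℕ) {n : ℕ} (β : Fin n → RTree d) :
    Summable fun t : RTree d => (galtonWatson lam d).real {t} * ∏ i, treeChaos lam d (β i) t := by
  classical
  induction d generalizing n with
  | zero => exact (RTree.hasSum_zero _).summable
  | succ d ih =>
    exact summable_prod_poissonChaos (φ := treeChaos lam d) (o := RTree.trivialTree d)
      (W := fun t => (galtonWatson lam (d + 1)).real {RTree.ofFinsupp t})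
      (galtonWatson_add_single hlam.le) (hasSum_galtonWatson hlam.le (d + 1)).summable
      (treeChaos_trivialTree d)
      (fun γ => by
        convert! hasSum_treeChaos_orthonormal hlam d γ (RTree.trivialTree d) using 1
        ext τ
        rw [treeChaos_trivialTree, mul_one])
      (fun k γ => ih γ) (fun i => (β i).mult)

theorem tendsto_tsum_prod_treeChaos_succ (d : ℕ)
    (hlim : ∀ (k : ℕ) (γ : Fin k → RTree d), ∃ l, Tendsto (fun lam => ∑' τ,
      (galtonWatson lam d).real {τ} * ∏ j, treeChaos lam d (γ j) τ) atTop (𝓝 l))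
    {n : ℕ} (β : Fin n → RTree (d + 1)) :
    Tendsto (fun lam => ∑' t : RTree (d + 1),
      (galtonWatson lam (d + 1)).real {t} * ∏ i, treeChaos lam (d + 1) (β i) t) atTop
      (𝓝 (∏ᶠ γ : RTree d, hermiteCoeff fun i => (β i).mult γ)) := by
  classical
  exact tendsto_tsum_prod_poissonChaos (φ := fun lam => treeChaos lam d)
    (o := RTree.trivialTree d) (p := fun lam τ => (galtonWatson lam d).real {τ})
    (W := fun lam t => (galtonWatson lam (d + 1)).real {RTree.ofFinsupp t})
    (fun lam hlam => galtonWatson_add_single hlam.le)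
    (fun lam hlam => hasSum_galtonWatson hlam.le (d + 1))
    (fun lam _ => treeChaos_trivialTree d)
    (fun lam hlam γ γ' => by convert! hasSum_treeChaos_orthonormal hlam d γ γ')
    (fun lam hlam k γ => summable_prod_treeChaos hlam d γ) hlim (fun i => (β i).mult)

/-- This closes the induction on depth: the limit at one level needs only that all moments one level
below converge, whatever their limits. -/
theorem exists_tendsto_tsum_prod_treeChaos (d : ℕ) {n : ℕ} (β : Fin n → RTree d) :
    ∃ l, Tendsto (fun lam => ∑' t : RTree d,
      (galtonWatson lam d).real {t} * ∏ i, treeChaos lam d (β i) t) atTop (𝓝 l) := by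
  induction d generalizing n with
  | zero =>
    refine ⟨1, tendsto_const_nhds.congr fun lam => ?_⟩
    rw [(RTree.hasSum_zero _).tsum_eq, galtonWatson_zero_real_singleton]
    simp [treeChaos]
  | succ d ih => exact ⟨_, tendsto_tsum_prod_treeChaos_succ d (fun _ γ => ih γ) β⟩

end TreeChaos

theorem theorem3 :
    ∃ f : ℝ → (d : ℕ) → RTree d → RTree d → ℝ,
      (∀ lam : ℝ, 0 < lam → ∀ d : ℕ,
        (∀ s ∈ Set.Icc (0 : ℝ) 1, ∀ t t' : RTree d,
          HasSum (fun β : RTree d => s ^ (β.size - 1) * f lam d β t * f lam d β t')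
            (likelihoodRatio lam s d t t')) ∧
        (∀ t : RTree d, f lam d (RTree.trivialTree d) t = 1) ∧
        (∀ β β' : RTree d,
          HasSum (fun t : RTree d => (galtonWatson lam d).real {t} * f lam d β t * f lam d β' t)
            (if β = β' then 1 else 0)) ∧
        (∀ t t' : RTree d,
          HasSum (fun β : RTree d => f lam d β t * f lam d β t')
            ((if t = t' then 1 else 0) / (galtonWatson lam d).real {t}))) ∧
      (∀ n : ℕ, 2 ≤ n → ∀ (d : ℕ) (β : Fin n → RTree (d + 1)),
        (∀ lam : ℝ, 0 < lam → Summable (fun t : RTree (d + 1) =>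
          (galtonWatson lam (d + 1)).real {t} * ∏ i, f lam (d + 1) (β i) t)) ∧
        Tendsto (fun lam : ℝ => ∑' t : RTree (d + 1),
            (galtonWatson lam (d + 1)).real {t} * ∏ i, f lam (d + 1) (β i) t)
          atTop (𝓝 (∏ᶠ γ : RTree d, hermiteCoeff (fun i => (β i).mult γ)))) :=
  ⟨treeChaos, fun _ hlam d =>
    ⟨fun _ hs => hasSum_treeChaos_likelihoodRatio hlam hs d, treeChaos_trivialTree d,
      hasSum_treeChaos_orthonormal hlam d, hasSum_treeChaos_complete hlam d⟩,
    fun _ _ d β => ⟨fun _ hlam => summable_prod_treeChaos hlam (d + 1) β,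
      tendsto_tsum_prod_treeChaos_succ d
        (fun _ γ => exists_tendsto_tsum_prod_treeChaos d γ) β⟩⟩
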